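/- **Language.** Let $\Phi_h=\{h_1,\dots,h_{n_h}\}$ (hypotheses) and $\Phi_o=\{ob_1,\dots,ob_{n_o}\}$ (observations) be finite nonempty sets of primitive propositions. Hypothesis formulas $\rho$ are built from $\Phi_h$ with $\neg,\wedge$. Basic terms are $\Pr^0(\rho)$, $\Pr(\rho)$ and $\mathrm w(ob,h)$. A polynomial term is a sum of products of integers, basic terms and variables. The language $\mathcal L^{fo\text{-}ev}(\Phi_h,\Phi_o)$ is obtained from the primitive propositions and the inequalities $p\ge c$ ($p$ a polynomial term, $c$ an integer) by closing under $\wedge$, $\neg$ and quantification $\forall x$; the other connectives and $=,\le,<,>$ are the usual abbreviations, and $\mathit{true}$ is $h_1\vee\neg h_1$. **Semantics.** An evidential world is a tuple $w=(h,ob,\mu,\mathcal E)$ with $h\in\Phi_h$, $ob\in\Phi_o$, $\mu$ a probability measure on $\Phi_h$, and $\mathcal E$ an evidence space: a probability measure $\mu_{h'}$ on $\Phi_o$ for every $h'\in\Phi_h$, such that for every $ob'\in\Phi_o$ some $\mu_{h'}(ob')>0$. Put $w_{\mathcal E}(ob',h')=\mu_{h'}(ob')/\sum_{h''}\mu_{h''}(ob')$.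 A posterior of $w$ is a probability measure $\nu$ on $\Phi_h$ that equals $\mu\oplus w_{\mathcal E}(ob,\cdot)$, i.e. $\nu(h')=\mu(h')w_{\mathcal E}(ob,h')/\sum_{h''}\mu(h'')w_{\mathcal E}(ob,h'')$, whenever this denominator is nonzero (if it is zero, every probability measure on $\Phi_h$ is a posterior of $w$). Let $[\![h']\!]=\{h'\}$, with $\neg$ and $\wedge$ read as complement and intersection. Variables range over the reals, $\Pr^0(\rho)$ denotes $\mu([\![\rho]\!])$, $\Pr(\rho)$ denotes $\nu([\![\rho]\!])$, $\mathrm w(ob',h')$ denotes $w_{\mathcal E}(ob',h')$; $h'$ is true at $w$ iff $h'=h$, and $ob'$ is true iff $ob'=ob$; everything else is interpreted as usual. A formula is valid if it is true at every evidential world, for every posterior of that world and every valuation of the variables. **Axiom system** $\mathbf{AX}(\Phi_h,\Phi_o)$: - Taut: all substitution instances (in the language) of valid formulas of first-order logic with equality. - MP: from $\phi$ and $\phi\Rightarrow\psi$ infer $\psi$. - RCF: all instances (in the language, with basic terms substituted for free variables) of formulas valid in all real closed fields. - H1: $h_1\vee\dots\vee h_{n_h}$. H2: $h_i\Rightarrow\neg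 h_j$ for $i\ne j$. O1: $ob_1\vee\dots\vee ob_{n_o}$. O2: $ob_i\Rightarrow\neg ob_j$ for $i\ne j$. - Pr1: $\Pr^0(\mathit{true})=1$. Pr2: $\Pr^0(\rho)\ge0$. Pr3: $\Pr^0(\rho_1\wedge\rho_2)+\Pr^0(\rho_1\wedge\neg\rho_2)=\Pr^0(\rho_1)$. Pr4: $\Pr^0(\rho_1)=\Pr^0(\rho_2)$ if $\rho_1\Leftrightarrow\rho_2$ is a tautological consequence of H1 and H2, i.e. holds under every truth assignment to $\Phi_h$ that makes exactly one hypothesis true. - Po1–Po4: the same with $\Pr$ in place of $\Pr^0$. - E1: $\mathrm w(ob,h)\ge0$. E2: $\sum_{i}\mathrm w(ob,h_i)=1$. E3: $ob\Rightarrow \Pr^0(h)\,\mathrm w(ob,h)=\sum_{i}\Pr(h)\Pr^0(h_i)\,\mathrm w(ob,h_i)$. E4: $\exists x_1\dots\exists x_{n_o}\bigl(\bigwedge_i x_i>0\wedge\bigwedge_j \sum_i \mathrm w(ob_i,h_j)x_i=1\bigr)$. **Theorem.** $\mathbf{AX}(\Phi_h,\Phi_o)$ is sound and complete for $\mathcal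 L^{fo\text{-}ev}(\Phi_h,\Phi_o)$ with respect to evidential worlds: a formula (with or without free variables) is provable in $\mathbf{AX}(\Phi_h,\Phi_o)$ if and only if it is valid. -/

import Mathlib

/-! A first-order logic of evidence.

The primitive propositions are the hypotheses `h_0, …, h_m` (indexed by `Fin (m + 1)`) and the
observations `ob_0, …, ob_k` (indexed by `Fin (k + 1)`); both sets are finite and nonempty.
Variables are indexed by `ℕ`. -/

namespace EvidenceLogic

/-! ### Syntax -/

/-- Hypothesis formulas: primitive hypotheses closed under negation and conjunction. -/
inductive HypForm (m : ℕ) : Type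
  | prim (h : Fin (m + 1)) : HypForm m
  | neg (ρ : HypForm m) : HypForm m
  | and (ρ₁ ρ₂ : HypForm m) : HypForm m

/-- Basic terms: `Pr⁰(ρ)`, `Pr(ρ)` and `w(ob, h)`. -/
inductive Basic (m k : ℕ) : Type
  | prior (ρ : HypForm m) : Basic m k
  | post (ρ : HypForm m) : Basic m k
  | weight (o : Fin (k + 1)) (h : Fin (m + 1)) : Basic m k

/-- Products of integers, basic terms and variables. -/
inductive Mono (m k : ℕ) : Type
  | int (a : ℤ) : Mono m k
  | basic (b : Basic m k) : Mono m k
  | var (x : ℕ) : Mono m k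
  | mul (t₁ t₂ : Mono m k) : Mono m k

/-- Polynomial terms `t₁ + ⋯ + tₙ`, each `tᵢ` a product. -/
inductive Poly (m k : ℕ) : Type
  | mono (t : Mono m k) : Poly m k
  | add (p₁ p₂ : Poly m k) : Poly m k

/-- Formulas: primitive propositions and polynomial inequalities `p ≥ c` (`c` an integer), closed
under negation, conjunction and first-order quantification. -/
inductive Form (m k : ℕ) : Type
  | hyp (h : Fin (m + 1)) : Form m k
  | obs (o : Fin (k + 1)) : Form m k
  | ge (p : Poly m k) (c : ℤ) : Form m k
  | neg (φ : Form m k) : Form m k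
  | and (φ ψ : Form m k) : Form m k
  | all (x : ℕ) (φ : Form m k) : Form m k

/-! ### Abbreviations -/

namespace HypForm

/-- `ρ₁ ∨ ρ₂`. -/
def or {m : ℕ} (ρ₁ ρ₂ : HypForm m) : HypForm m := neg (and (neg ρ₁) (neg ρ₂))

/-- `true`, the tautology `h ∨ ¬ h` for the first hypothesis `h`. -/
def tru (m : ℕ) : HypForm m := or (prim 0) (neg (prim 0))

end HypForm

namespace Poly

variable {m k : ℕ}

/-- The basic term `b`, as a polynomial term. -/
def basic (b : Basic m k) : Poly m k := mono (Mono.basic b)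

/-- `-p`: every summand is multiplied by the integer `-1`. -/
def neg : Poly m k → Poly m k
  | mono t => mono (Mono.mul (Mono.int (-1)) t)
  | add p₁ p₂ => add (neg p₁) (neg p₂)

/-- `p - q`. -/
def sub (p q : Poly m k) : Poly m k := add p (neg q)

/-- `f 0 + ⋯ + f n`. -/
def sum : (n : ℕ) → (Fin (n + 1) → Poly m k) → Poly m k
  | 0, f => f 0
  | n + 1, f => add (sum n (fun i => f i.castSucc)) (f (Fin.last (n + 1)))

end Poly

namespace Form

variable {m k : ℕ}

/-- `φ ∨ ψ`. -/
def or (φ ψ : Form m k) : Form m k := neg (and (neg φ) (neg ψ))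

/-- `φ ⇒ ψ`. -/
def imp (φ ψ : Form m k) : Form m k := or (neg φ) ψ

/-- `∃ x φ`. -/
def ex (x : ℕ) (φ : Form m k) : Form m k := neg (all x (neg φ))

/-- `∃ x_0 … ∃ x_(n-1) φ`. -/
def exs : ℕ → Form m k → Form m k
  | 0, φ => φ
  | n + 1, φ => exs n (ex n φ)

/-- `p ≤ c`. -/
def le (p : Poly m k) (c : ℤ) : Form m k := ge p.neg (-c)

/-- `p > c`. -/
def gt (p : Poly m k) (c : ℤ) : Form m k := neg (le p c)

/-- `p = c` for an integer `c`. -/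
def eqInt (p : Poly m k) (c : ℤ) : Form m k := and (ge p c) (le p c)

/-- `p = q` for polynomial terms. -/
def eq (p q : Poly m k) : Form m k := eqInt (p.sub q) 0

/-- `f 0 ∧ ⋯ ∧ f n`. -/
def conj : (n : ℕ) → (Fin (n + 1) → Form m k) → Form m k
  | 0, f => f 0
  | n + 1, f => and (conj n (fun i => f i.castSucc)) (f (Fin.last (n + 1)))

/-- `f 0 ∨ ⋯ ∨ f n`. -/
def disj : (n : ℕ) → (Fin (n + 1) → Form m k) → Form m k
  | 0, f => f 0
  | n + 1, f => or (disj n (fun i => f i.castSucc)) (f (Fin.last (n + 1)))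

/-- `φ` contains no primitive proposition (outside the scope of `Pr⁰`, `Pr` and `w`). -/
def PropFree : Form m k → Prop
  | hyp _ => False
  | obs _ => False
  | ge _ _ => True
  | neg φ => φ.PropFree
  | and φ ψ => φ.PropFree ∧ ψ.PropFree
  | all _ φ => φ.PropFree

end Form

/-! ### First-order structures for the language -/

/-- A first-order structure for the language: the primitive propositions are read as propositional
letters, the basic terms and the integers as constants, `+`, `·` and `≥` as arbitrary operations
and an arbitrary relation on the carrier. -/
structure FOStr (m k : ℕ) (D : Type) where
  add : D → D → D
  mul : D → D → D
  int : ℤ → D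
  ge : D → D → Prop
  basic : Basic m k → D
  hyp : Fin (m + 1) → Prop
  obs : Fin (k + 1) → Prop

namespace FOStr

variable {m k : ℕ} {D : Type}

/-- The value of a product. -/
def valMono (M : FOStr m k D) (v : ℕ → D) : Mono m k → D
  | Mono.int a => M.int a
  | Mono.basic b => M.basic b
  | Mono.var x => v x
  | Mono.mul t₁ t₂ => M.mul (M.valMono v t₁) (M.valMono v t₂)

/-- The value of a polynomial term. -/
def val (M : FOStr m k D) (v : ℕ → D) : Poly m k → D
  | Poly.mono t => M.valMono v t
  | Poly.add p₁ p₂ => M.add (M.val v p₁) (M.val v p₂)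

/-- Truth of a formula in a structure under a valuation of the variables. -/
def Sat (M : FOStr m k D) : (ℕ → D) → Form m k → Prop
  | _, Form.hyp h => M.hyp h
  | _, Form.obs o => M.obs o
  | v, Form.ge p c => M.ge (M.val v p) (M.int c)
  | v, Form.neg φ => ¬ M.Sat v φ
  | v, Form.and φ ψ => M.Sat v φ ∧ M.Sat v ψ
  | v, Form.all x φ => ∀ a : D, M.Sat (Function.update v x a) φ

/-- The formula `x = y` (which abbreviates a conjunction of two inequalities) expresses identity,
as the equality symbol does in first-order logic with equality. -/
def Normal (M : FOStr m k D) : Prop :=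
  ∀ v : ℕ → D,
    M.Sat v (Form.eq (Poly.mono (Mono.var 0)) (Poly.mono (Mono.var 1))) ↔ v 0 = v 1

/-- An ordered field as a structure, given values for the basic terms and truth values for the
primitive propositions. -/
def ofField {R : Type} [Field R] [LinearOrder R] (b : Basic m k → R)
    (hy : Fin (m + 1) → Prop) (ob : Fin (k + 1) → Prop) : FOStr m k R where
  add x y := x + y
  mul x y := x * y
  int a := (a : R)
  ge x y := x ≥ y
  basic := b
  hyp := hy
  obs := ob

end FOStr

/-! ### Evidential worlds -/

/-- The set of hypotheses denoted by a hypothesis formula. -/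
def HypForm.intension {m : ℕ} : HypForm m → Finset (Fin (m + 1))
  | prim h => {h}
  | neg ρ => (Finset.univ : Finset (Fin (m + 1))) \ ρ.intension
  | and ρ₁ ρ₂ => ρ₁.intension ∩ ρ₂.intension

/-- An evidence space: a likelihood function `μ_h` (a probability measure on the observations) for
every hypothesis, such that every observation has positive probability under some hypothesis. -/
structure EvidenceSpace (m k : ℕ) where
  lik : Fin (m + 1) → Fin (k + 1) → ℝ
  lik_mem : ∀ h, lik h ∈ stdSimplex ℝ (Fin (k + 1))
  relevant : ∀ o, ∃ h, 0 < lik h o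

/-- The weight of evidence that the observation `o` lends to the hypothesis `h`. -/
noncomputable def EvidenceSpace.weight {m k : ℕ} (E : EvidenceSpace m k)
    (o : Fin (k + 1)) (h : Fin (m + 1)) : ℝ :=
  E.lik h o / ∑ h', E.lik h' o

/-- Dempster's rule of combination `μ₁ ⊕ μ₂`, on points; it is meaningful only if
`∑ h, μ₁ h * μ₂ h ≠ 0`. -/
noncomputable def dempster {m : ℕ} (μ₁ μ₂ : Fin (m + 1) → ℝ) (h : Fin (m + 1)) : ℝ :=
  μ₁ h * μ₂ h / ∑ h', μ₁ h' * μ₂ h'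

/-- An evidential world `(h, ob, μ, E)`. -/
structure World (m k : ℕ) where
  hyp : Fin (m + 1)
  obs : Fin (k + 1)
  prior : Fin (m + 1) → ℝ
  prior_mem : prior ∈ stdSimplex ℝ (Fin (m + 1))
  ev : EvidenceSpace m k

/-- `ν` is a posterior of the world: a probability measure on the hypotheses which is the result
`μ ⊕ w(ob, ·)` of Dempster's rule whenever that is defined. If the prior probability of the
observation is `0`, the rule reads `0 / 0` and does not constrain `ν`. -/
def World.IsPosterior {m k : ℕ} (w : World m k) (ν : Fin (m + 1) → ℝ) : Prop :=
  ν ∈ stdSimplex ℝ (Fin (m + 1)) ∧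
    (∑ h, w.prior h * w.ev.weight w.obs h ≠ 0 → ν = dempster w.prior (w.ev.weight w.obs))

/-- The values of the basic terms at a world with posterior `ν`. -/
noncomputable def World.basicVal {m k : ℕ} (w : World m k) (ν : Fin (m + 1) → ℝ) :
    Basic m k → ℝ
  | Basic.prior ρ => ∑ h ∈ ρ.intension, w.prior h
  | Basic.post ρ => ∑ h ∈ ρ.intension, ν h
  | Basic.weight o h => w.ev.weight o h

/-- Truth at an evidential world `w` with posterior `ν`, under a valuation of the variables by real
numbers: polynomial inequalities and quantifiers are interpreted over the reals. -/
def World.Sat {m k : ℕ} (w : World m k) (ν : Fin (m + 1) → ℝ) (v : ℕ → ℝ) (φ : Form m k) : Prop :=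
  (FOStr.ofField (w.basicVal ν) (fun h => w.hyp = h) (fun o => w.obs = o)).Sat v φ

/-- Validity in all evidential worlds. -/
def Valid {m k : ℕ} (φ : Form m k) : Prop :=
  ∀ (w : World m k) (ν : Fin (m + 1) → ℝ), w.IsPosterior ν → ∀ v : ℕ → ℝ, w.Sat ν v φ

/-! ### The axiom system -/

/-- Instances of valid formulas of first-order logic with equality: the formulas of the language
that are true in every nonempty first-order structure in which equality is identity. (A
substitution instance of a valid formula is true in all of these structures, and a formula true in
all of them is an instance of itself.) -/
def IsTaut {m k : ℕ} (φ : Form m k) : Prop :=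
  ∀ (D : Type) [Nonempty D] (M : FOStr m k D), M.Normal → ∀ v : ℕ → D, M.Sat v φ

/-- Instances of formulas valid in real closed fields: formulas without primitive propositions that
hold in every real closed field, whatever elements are put for the variables and for the basic
terms (a basic term is what a free variable of the valid formula has been replaced by). -/
def IsRCF {m k : ℕ} (φ : Form m k) : Prop :=
  φ.PropFree ∧
    ∀ (R : Type) [Field R] [LinearOrder R] [IsStrictOrderedRing R] [IsRealClosed R]
      (b : Basic m k → R) (v : ℕ → R),
      (FOStr.ofField b (fun _ => False) (fun _ => False)).Sat v φ

/-- Truth of a hypothesis formula under a truth assignment to the hypotheses. -/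
def HypForm.Holds {m : ℕ} (t : Fin (m + 1) → Prop) : HypForm m → Prop
  | prim h => t h
  | neg ρ => ¬ ρ.Holds t
  | and ρ₁ ρ₂ => ρ₁.Holds t ∧ ρ₂.Holds t

/-- `ρ₁ ⇔ ρ₂` is a tautology given that exactly one hypothesis is true: it holds under every truth
assignment that satisfies the axioms `H1` and `H2`. -/
def HypForm.TautEquiv {m : ℕ} (ρ₁ ρ₂ : HypForm m) : Prop :=
  ∀ t : Fin (m + 1) → Prop, (∃ i, t i) → (∀ i j, i ≠ j → t i → ¬ t j) →
    (ρ₁.Holds t ↔ ρ₂.Holds t)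

/-- The term `Pr⁰(ρ)`. -/
def pr0 {m k : ℕ} (ρ : HypForm m) : Poly m k := Poly.basic (Basic.prior ρ)

/-- The term `Pr(ρ)`. -/
def pr {m k : ℕ} (ρ : HypForm m) : Poly m k := Poly.basic (Basic.post ρ)

/-- The term `w(ob, h)`. -/
def wt {m k : ℕ} (o : Fin (k + 1)) (h : Fin (m + 1)) : Poly m k :=
  Poly.basic (Basic.weight o h)

/-- Axiom `E3`: `ob ⇒ (Pr⁰(h) w(ob,h) = Pr(h) Pr⁰(h_0) w(ob,h_0) + ⋯ + Pr(h) Pr⁰(h_m) w(ob,h_m))`. -/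
def axiomE3 {m k : ℕ} (o : Fin (k + 1)) (h : Fin (m + 1)) : Form m k :=
  Form.imp (Form.obs o)
    (Form.eq
      (Poly.mono (Mono.mul (Mono.basic (Basic.prior (HypForm.prim h)))
        (Mono.basic (Basic.weight o h))))
      (Poly.sum m fun i =>
        Poly.mono (Mono.mul (Mono.basic (Basic.post (HypForm.prim h)))
          (Mono.mul (Mono.basic (Basic.prior (HypForm.prim i)))
            (Mono.basic (Basic.weight o i))))))

/-- Axiom `E4`: `∃ x_0 … ∃ x_k (x_0 > 0 ∧ ⋯ ∧ x_k > 0 ∧ ⋀_j (∑_i w(ob_i,h_j) x_i = 1))`. -/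
def axiomE4 (m k : ℕ) : Form m k :=
  Form.exs (k + 1)
    (Form.and
      (Form.conj k fun i => Form.gt (Poly.mono (Mono.var (i : ℕ))) 0)
      (Form.conj m fun j =>
        Form.eqInt
          (Poly.sum k fun i =>
            Poly.mono (Mono.mul (Mono.basic (Basic.weight i j)) (Mono.var (i : ℕ)))) 1))

/-- Provability in the axiom system. -/
inductive Provable {m k : ℕ} : Form m k → Prop
  | taut (φ : Form m k) : IsTaut φ → Provable φ
  | mp (φ ψ : Form m k) : Provable φ → Provable (Form.imp φ ψ) → Provable ψ
  | rcf (φ : Form m k) : IsRCF φ → Provable φ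
  | h1 : Provable (Form.disj m fun i => Form.hyp i)
  | h2 (i j : Fin (m + 1)) : i ≠ j → Provable (Form.imp (Form.hyp i) (Form.neg (Form.hyp j)))
  | o1 : Provable (Form.disj k fun i => Form.obs i)
  | o2 (i j : Fin (k + 1)) : i ≠ j → Provable (Form.imp (Form.obs i) (Form.neg (Form.obs j)))
  | pr1 : Provable (Form.eqInt (pr0 (HypForm.tru m)) 1)
  | pr2 (ρ : HypForm m) : Provable (Form.ge (pr0 ρ) 0)
  | pr3 (ρ₁ ρ₂ : HypForm m) : Provable
      (Form.eq (Poly.add (pr0 (ρ₁.and ρ₂)) (pr0 (ρ₁.and ρ₂.neg))) (pr0 ρ₁))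
  | pr4 (ρ₁ ρ₂ : HypForm m) : ρ₁.TautEquiv ρ₂ → Provable (Form.eq (pr0 ρ₁) (pr0 ρ₂))
  | po1 : Provable (Form.eqInt (pr (HypForm.tru m)) 1)
  | po2 (ρ : HypForm m) : Provable (Form.ge (pr ρ) 0)
  | po3 (ρ₁ ρ₂ : HypForm m) : Provable
      (Form.eq (Poly.add (pr (ρ₁.and ρ₂)) (pr (ρ₁.and ρ₂.neg))) (pr ρ₁))
  | po4 (ρ₁ ρ₂ : HypForm m) : ρ₁.TautEquiv ρ₂ → Provable (Form.eq (pr ρ₁) (pr ρ₂))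
  | e1 (o : Fin (k + 1)) (h : Fin (m + 1)) : Provable (Form.ge (wt o h) 0)
  | e2 (o : Fin (k + 1)) : Provable (Form.eqInt (Poly.sum m fun h => wt o h) 1)
  | e3 (o : Fin (k + 1)) (h : Fin (m + 1)) : Provable (axiomE3 o h)
  | e4 : Provable (axiomE4 m k)

end EvidenceLogic

/-! Soundness is a check of each axiom. Only two need thought: E3 when the denominator of Dempster's
rule vanishes (then every term of that sum of nonnegative products vanishes, so both sides are zero
whatever the posterior is), and E4, whose witnesses are the sums of likelihoods `∑ h, E.lik h o`.

Completeness is a direct derivation, without maximal consistent sets. By H1 and O1 it suffices to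
derive a valid `φ` from `h_i ∧ ob_j`, for each of the finitely many pairs. Under that premise H2 and
O2 fix all truth values, so `φ` may be replaced by the proposition-free `φ.resolve i j`, and E3
yields its conclusion for `ob_j`. Real values of the basic terms that satisfy those conclusions,
finitely many other axioms, and the provable equations writing each `Pr⁰(ρ)` and `Pr(ρ)` in `φ` as a
sum over hypotheses, come from an actual world (`exists_world`): if `x` is a witness of E4, the
likelihoods are `w(o,h) x_o`. Hence the implication from these premises to `φ.resolve i j` holds
over the reals.

The schema RCF demands truth in every real closed field, so Tarski's transfer principle is needed
(`isRCF_of_forall_real`); it takes up the first half of the proof. The method is that of Cohen and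
Hörmander: close a finite set of polynomials in one variable under derivatives, truncations and
pseudo-remainders; the signs of the leading coefficients then determine which sign patterns occur
(`exists_finset_forall_exists_sign_eq`). This eliminates one quantifier at a time. The analysis
behind it (intermediate values, Rolle) is obtained algebraically from the fact that irreducible
polynomials over a real closed field have degree at most two. -/

namespace EvidenceLogic

/-! ### Irreducible polynomials over a real closed field have degree at most two. -/

open Polynomial IntermediateField in
-- The minimal polynomial of a primitive element has odd degree, hence a root in `R`; being
-- irreducible, it is linear.
theorem finrank_eq_one_of_odd {R E : Type*} [Field R] [CharZero R] [IsRealClosed R] [Field E]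
    [Algebra R E] [FiniteDimensional R E] (h : Odd (Module.finrank R E)) :
    Module.finrank R E = 1 := by
  obtain ⟨α, hα⟩ := Field.exists_primitive_element R E
  rw [Field.primitive_element_iff_minpoly_natDegree_eq] at hα
  rw [← hα] at h ⊢
  obtain ⟨x, hx⟩ := IsRealClosed.exists_isRoot_of_odd_natDegree h
  exact natDegree_eq_of_degree_eq_some
    (degree_eq_one_of_irreducible_of_root (minpoly.irreducible (Algebra.IsIntegral.isIntegral α)) hx)

open IntermediateField in
-- The fixed field of a Sylow 2-subgroup has odd degree over `R`, hence degree one, so the Galois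
-- group is itself a 2-group.
theorem exists_finrank_eq_two_pow {R E : Type*} [Field R] [CharZero R] [IsRealClosed R] [Field E]
    [Algebra R E] [FiniteDimensional R E] [IsGalois R E] :
    ∃ n, Module.finrank R E = 2 ^ n := by
  have : Fact (Nat.Prime 2) := ⟨Nat.prime_two⟩
  let P : Sylow 2 Gal(E/R) := default
  have h1 : Module.finrank R (fixedField (P : Subgroup Gal(E/R))) =
      (P : Subgroup Gal(E/R)).index := by
    rw [finrank_eq_fixingSubgroup_index, fixingSubgroup_fixedField]
  have h2 : ¬ 2 ∣ (P : Subgroup Gal(E/R)).index := P.not_dvd_index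
  have h3 := finrank_eq_one_of_odd (R := R) (E := fixedField (P : Subgroup Gal(E/R)))
    (by rw [h1, ← Nat.not_even_iff_odd, even_iff_two_dvd]; exact h2)
  have h4 : Nat.card (P : Subgroup Gal(E/R)) = Nat.card Gal(E/R) := by
    rw [← (P : Subgroup Gal(E/R)).card_mul_index, ← h1, h3, mul_one]
  obtain ⟨n, hn⟩ := IsPGroup.iff_card.1 P.isPGroup'
  exact ⟨n, by rw [← IsGalois.card_aut_eq_finrank, ← h4, hn]⟩

open Polynomial in
theorem finrank_ne_two_of_isSquare {K F : Type*} [Field K] [CharZero K] [Field F] [Algebra K F]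
    [FiniteDimensional K F] (h : ∀ x : K, IsSquare x) : Module.finrank K F ≠ 2 := by
  intro h2
  obtain ⟨α, hα⟩ := Field.exists_primitive_element K F
  rw [Field.primitive_element_iff_minpoly_natDegree_eq, h2] at hα
  have hirr := minpoly.irreducible (Algebra.IsIntegral.isIntegral (R := K) α)
  have hm := minpoly.monic (Algebra.IsIntegral.isIntegral (R := K) α)
  -- A quarter of the discriminant; its square root feeds the quadratic formula.
  obtain ⟨s, hs⟩ := h (((minpoly K α).coeff 1) ^ 2 / 4 - (minpoly K α).coeff 0)
  have hroot : (minpoly K α).IsRoot (s - (minpoly K α).coeff 1 / 2) := by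
    have h4 : (minpoly K α).coeff 2 = 1 := by
      rw [← hα]; exact hm
    rw [IsRoot, eval_eq_sum_range, hα]
    simp only [Finset.sum_range_succ, Finset.sum_range_zero, h4]
    linear_combination -hs
  have : (minpoly K α).natDegree = 1 :=
    natDegree_eq_of_degree_eq_some (degree_eq_one_of_irreducible_of_root hirr hroot)
  omega

section

variable {R : Type*} [Field R] [LinearOrder R] [IsStrictOrderedRing R] [IsRealClosed R]

/-- The usual complex square root: with `r = √(a² + b²)`, its parts are `√((r + a)/2)` and `±√((r -
a)/2)`, the sign being chosen so that twice their product is `b`. -/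
theorem isSquare_add_mul_of_sq_eq_neg_one {E : Type*} [Field E] [Algebra R E] {i : E}
    (hi : i ^ 2 = -1) (a b : R) :
    ∃ c d : R, (algebraMap R E a + algebraMap R E b * i) =
      (algebraMap R E c + algebraMap R E d * i) ^ 2 := by
  obtain ⟨r0, hr0⟩ := IsSquare.of_nonneg (show (0 : R) ≤ a ^ 2 + b ^ 2 by positivity)
  obtain ⟨r, hr, hr1⟩ : ∃ r : R, 0 ≤ r ∧ a ^ 2 + b ^ 2 = r ^ 2 :=
    ⟨|r0|, abs_nonneg _, by rw [sq_abs, hr0, sq]⟩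
  have ha : |a| ≤ r := abs_le_of_sq_le_sq (by nlinarith [sq_nonneg b]) hr
  obtain ⟨u, hu⟩ := IsSquare.of_nonneg (show (0 : R) ≤ (r + a) / 2 by
    linarith [neg_abs_le a])
  obtain ⟨v, hv⟩ := IsSquare.of_nonneg (show (0 : R) ≤ (r - a) / 2 by
    linarith [le_abs_self a])
  have huv : (2 * u * v) ^ 2 = b ^ 2 := by
    have : (2 * u * v) ^ 2 = 4 * (u * u) * (v * v) := by ring
    rw [this, ← hu, ← hv]
    linear_combination -hr1
  have key : ∀ w : R, v * v = w * w → 2 * u * w = b →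
      (algebraMap R E a + algebraMap R E b * i) =
      (algebraMap R E u + algebraMap R E w * i) ^ 2 := by
    intro w hw hb
    have h1 : a = u ^ 2 - w ^ 2 := by linear_combination hu - hv - hw
    rw [← hb, h1]
    simp only [map_sub, map_mul, map_pow, map_ofNat]
    linear_combination (-(algebraMap R E w) ^ 2) * hi
  rcases sq_eq_sq_iff_eq_or_eq_neg.1 huv with h | h
  · exact ⟨u, v, key v rfl h⟩
  · exact ⟨u, -v, key (-v) (by ring) (by linear_combination -h)⟩

open IntermediateField in
theorem isSquare_of_mem_adjoin {E : Type*} [Field E] [Algebra R E] {i : E} (hi : i ^ 2 = -1)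
    (x : R⟮i⟯) : IsSquare x := by
  have hint : IsAlgebraic R i := by
    refine ⟨Polynomial.X ^ 2 + 1, ?_, by simp [hi]⟩
    exact (Polynomial.monic_X_pow_add_C (1 : R) two_ne_zero).ne_zero
  have hrep : ∀ y ∈ Algebra.adjoin R {i}, ∃ a b : R, y = algebraMap R E a + algebraMap R E b * i := by
    intro y hy
    induction hy using Algebra.adjoin_induction with
    | mem y hy => exact ⟨0, 1, by simpa using hy⟩
    | algebraMap r => exact ⟨r, 0, by simp⟩
    | add y z _ _ hy hz =>
      obtain ⟨a, b, rfl⟩ := hy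
      obtain ⟨c, d, rfl⟩ := hz
      exact ⟨a + c, b + d, by simp only [map_add]; ring⟩
    | mul y z _ _ hy hz =>
      obtain ⟨a, b, rfl⟩ := hy
      obtain ⟨c, d, rfl⟩ := hz
      refine ⟨a * c - b * d, a * d + b * c, ?_⟩
      simp only [map_add, map_sub, map_mul]
      linear_combination (algebraMap R E b * algebraMap R E d) * hi
  have hx : (x : E) ∈ Algebra.adjoin R {i} := by
    rw [← adjoin_simple_toSubalgebra_of_isAlgebraic hint]
    exact x.2
  obtain ⟨a, b, hab⟩ := hrep _ hx
  obtain ⟨c, d, hcd⟩ := isSquare_add_mul_of_sq_eq_neg_one hi a b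
  have hmem : algebraMap R E c + algebraMap R E d * i ∈ R⟮i⟯ :=
    add_mem (_root_.algebraMap_mem _ _) (mul_mem (_root_.algebraMap_mem _ _) (mem_adjoin_simple_self R i))
  refine ⟨⟨_, hmem⟩, Subtype.ext ?_⟩
  rw [hab, hcd, sq]
  rfl

open IntermediateField in
-- The degree of `E` over `R⟮i⟯` is a power of two. Were it not one, the Galois group would have a
-- subgroup of index two, whose fixed field is a quadratic extension of `R⟮i⟯`; but every element of
-- `R⟮i⟯` is a square.
theorem finrank_le_two_of_sq_eq_neg_one {E : Type*} [Field E] [Algebra R E]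
    [FiniteDimensional R E] [IsGalois R E] {i : E} (hi : i ^ 2 = -1) :
    Module.finrank R E ≤ 2 := by
  obtain ⟨n, hn⟩ := exists_finrank_eq_two_pow (R := R) (E := E)
  have hK : Module.finrank R R⟮i⟯ ≤ 2 := by
    rw [adjoin.finrank (Algebra.IsIntegral.isIntegral i)]
    have hp : (Polynomial.X ^ 2 + 1 : Polynomial R).Monic :=
      Polynomial.monic_X_pow_add_C (1 : R) two_ne_zero
    have := Polynomial.natDegree_le_of_dvd (minpoly.dvd R i (p := Polynomial.X ^ 2 + 1) (by simp [hi]))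
      hp.ne_zero
    refine this.trans (le_of_eq ?_)
    exact Polynomial.natDegree_X_pow_add_C (n := 2) (r := (1 : R))
  have hmul := Module.finrank_mul_finrank R R⟮i⟯ E
  obtain ⟨m, -, hm⟩ := (Nat.dvd_prime_pow Nat.prime_two).1 (hn ▸ hmul ▸ Dvd.intro_left _ rfl :
    Module.finrank R⟮i⟯ E ∣ 2 ^ n)
  have hm0 : m = 0 := by
    by_contra hm0
    obtain ⟨l, rfl⟩ := Nat.exists_eq_succ_of_ne_zero hm0
    have : Fact (Nat.Prime 2) := ⟨Nat.prime_two⟩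
    have hcard : Nat.card Gal(E/R⟮i⟯) = 2 ^ (l + 1) := by
      rw [IsGalois.card_aut_eq_finrank, hm]
    obtain ⟨H, hH⟩ := Sylow.exists_subgroup_card_pow_prime (G := Gal(E/R⟮i⟯)) 2 (n := l)
      (by rw [hcard]; exact pow_dvd_pow _ (Nat.le_succ l))
    have h1 : Module.finrank R⟮i⟯ (fixedField H) = 2 := by
      rw [finrank_eq_fixingSubgroup_index, fixingSubgroup_fixedField]
      have := H.card_mul_index
      rw [hH, hcard, pow_succ] at this
      exact Nat.eq_of_mul_eq_mul_left (by positivity) this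
    exact finrank_ne_two_of_isSquare (isSquare_of_mem_adjoin hi) h1
  rw [hm0, pow_zero] at hm
  rw [← hmul, hm, mul_one]
  exact hK

open Polynomial in
theorem natDegree_le_two_of_irreducible {f : R[X]} (hf : Irreducible f) : f.natDegree ≤ 2 := by
  have hg : (X ^ 2 + 1 : R[X]).Monic := monic_X_pow_add_C (1 : R) two_ne_zero
  -- The factor `X ^ 2 + 1` puts a square root of `-1` into the field, which then has degree at most
  -- two over `R` and contains a root of `f`.
  let N := (f * (X ^ 2 + 1)).SplittingField
  have hs : ((f * (X ^ 2 + 1)).map (algebraMap R N)).Splits :=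
    SplittingField.splits _
  have hne : (f * (X ^ 2 + 1)).map (algebraMap R N) ≠ 0 :=
    Polynomial.map_ne_zero (mul_ne_zero hf.ne_zero hg.ne_zero)
  rw [Polynomial.map_mul] at hs hne
  have hs1 := hs.of_dvd hne (dvd_mul_right _ _)
  have hs2 := hs.of_dvd hne (dvd_mul_left _ _)
  obtain ⟨i, hi⟩ := hs2.exists_eval_eq_zero (by
    rw [degree_map]
    have : (X ^ 2 + 1 : R[X]).degree = 2 := by
      simpa using degree_X_pow_add_C (n := 2) (by norm_num) (1 : R)
    rw [this]; norm_num)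
  obtain ⟨α, hα⟩ := hs1.exists_eval_eq_zero (by
    rw [degree_map]
    exact (degree_pos_of_irreducible hf).ne')
  have : IsGalois R N := IsGalois.mk
  have h2 := finrank_le_two_of_sq_eq_neg_one (R := R) (E := N) (i := i) (by
    simp at hi; linear_combination hi)
  have h3 := minpoly.natDegree_le (A := R) α
  have h4 : minpoly R α ∣ f := minpoly.dvd R α (by rw [aeval_def, ← eval_map]; exact hα)
  have h5 := (hf.dvd_iff.1 h4).resolve_left
    (minpoly.not_isUnit R α)
  have h6 : f.natDegree = (minpoly R α).natDegree := natDegree_eq_of_degree_eq (degree_eq_degree_of_associated h5)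
  omega

end

section

open Polynomial

/-! ### Polynomials over real closed fields -/

section

variable {R : Type*} [Field R] [LinearOrder R] [IsStrictOrderedRing R]

/-- Induction through `f = X * divX f + f(0)`. A positive lower bound, not just positivity, is
needed for the product with `x` to outgrow `f(0)`. -/
theorem exists_pos_forall_le_eval {f : R[X]} (hf : 0 < f.leadingCoeff) :
    ∃ ε > 0, ∃ M, ∀ x ≥ M, ε ≤ f.eval x := by
  induction hn : f.natDegree generalizing f with
  | zero =>
    rw [natDegree_eq_zero] at hn
    obtain ⟨c, rfl⟩ := hn
    exact ⟨c, by simpa using hf, 0, fun x _ => by simp⟩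
  | succ n ih =>
    have hd : f.divX.natDegree = n := by rw [natDegree_divX_eq_natDegree_tsub_one, hn]; rfl
    have hl : f.divX.leadingCoeff = f.leadingCoeff := by
      rw [leadingCoeff, leadingCoeff, hd, hn, coeff_divX]
    obtain ⟨ε, hε, M, hM⟩ := ih (hl ▸ hf) hd
    refine ⟨1, one_pos, max M (max 0 ((1 - f.coeff 0) / ε)), fun x hx => ?_⟩
    rw [ge_iff_le, max_le_iff, max_le_iff, div_le_iff₀ hε] at hx
    have h1 := mul_le_mul_of_nonneg_right (hM x hx.1) hx.2.1
    have h2 : f.eval x = f.divX.eval x * x + f.coeff 0 := by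
      conv_lhs => rw [← divX_mul_X_add f]
      simp
    linarith [hx.2.2]

theorem exists_forall_ge_sign_eval {f : R[X]} (hf : f ≠ 0) :
    ∃ M, ∀ x ≥ M, SignType.sign (f.eval x) = SignType.sign f.leadingCoeff := by
  rcases lt_or_gt_of_ne (leadingCoeff_ne_zero.2 hf) with h | h
  · obtain ⟨ε, hε, M, hM⟩ := exists_pos_forall_le_eval (f := -f) (by simpa using h)
    refine ⟨M, fun x hx => ?_⟩
    have := hM x hx
    rw [eval_neg] at this
    rw [sign_neg h, sign_neg (by linarith)]
  · obtain ⟨ε, hε, M, hM⟩ := exists_pos_forall_le_eval h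
    refine ⟨M, fun x hx => ?_⟩
    rw [sign_pos h, sign_pos (hε.trans_le (hM x hx))]

theorem exists_forall_le_sign_eval {f : R[X]} (hf : f ≠ 0) :
    ∃ M, ∀ x ≤ M, SignType.sign (f.eval x) =
      SignType.sign ((-1) ^ f.natDegree * f.leadingCoeff) := by
  have h0 : f.comp (-X) ≠ 0 := by
    rwa [Ne, comp_neg_X_eq_zero_iff]
  obtain ⟨M, hM⟩ := exists_forall_ge_sign_eval h0
  refine ⟨-M, fun x hx => ?_⟩
  have := hM (-x) (by linarith)
  rwa [comp_neg_X_leadingCoeff_eq, eval_comp, eval_neg, eval_X, neg_neg] at this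

end

/-- A polynomial of odd degree has opposite signs far to the left and far to the right, so the
analytic intermediate value theorem gives a root. -/
instance : IsRealClosed ℝ := by
  refine IsRealClosed.of_linearOrderedField (fun h => ⟨_, (Real.mul_self_sqrt h).symm⟩) ?_
  intro f hf
  have h0 : f ≠ 0 := by rintro rfl; simp at hf
  obtain ⟨M, hM⟩ := exists_forall_ge_sign_eval h0
  obtain ⟨N, hN⟩ := exists_forall_le_sign_eval h0
  have h1 := hM (max M N) (le_max_left _ _)
  have h2 := hN (min M N) (min_le_right _ _)
  rw [hf.neg_one_pow, neg_one_mul, Left.sign_neg] at h2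
  have hc : ContinuousOn (fun x => f.eval x) (Set.uIcc (min M N) (max M N)) :=
    f.continuous.continuousOn
  have := intermediate_value_uIcc hc
  have h3 : (0 : ℝ) ∈ Set.uIcc (f.eval (min M N)) (f.eval (max M N)) := by
    rw [← h1] at h2
    rw [Set.mem_uIcc]
    rcases lt_trichotomy (f.eval (max M N)) 0 with h | h | h
    · rw [sign_neg h, neg_neg, sign_eq_one_iff] at h2
      exact Or.inr ⟨h.le, h2.le⟩
    · rw [h]; exact le_total _ _ |>.imp (fun h => ⟨h, le_rfl⟩) (fun h => ⟨le_rfl, h⟩)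
    · rw [sign_pos h, sign_eq_neg_one_iff] at h2
      exact Or.inl ⟨h2.le, h.le⟩
  obtain ⟨c, -, hc⟩ := this h3
  exact ⟨c, hc⟩

section

variable {R : Type*} [Field R] [LinearOrder R] [IsStrictOrderedRing R] [IsRealClosed R]

/-- Such a `p` is a quadratic without roots, so its discriminant is negative; completing the square
shows that it has constant sign. -/
theorem mul_eval_nonneg_of_irreducible_of_natDegree_ne_one {p : R[X]} (hp : Irreducible p)
    (h1 : p.natDegree ≠ 1) (a b : R) : 0 ≤ p.eval a * p.eval b := by
  have h2 : p.natDegree = 2 := by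
    have := natDegree_le_two_of_irreducible hp
    have := hp.natDegree_pos
    omega
  have hev : ∀ x, p.eval x = p.coeff 0 + p.coeff 1 * x + p.coeff 2 * x ^ 2 := by
    intro x
    rw [eval_eq_sum_range, h2]
    simp only [Finset.sum_range_succ, Finset.sum_range_zero]
    ring
  have hA : p.coeff 2 ≠ 0 := by
    rw [← h2]; exact leadingCoeff_ne_zero.2 hp.ne_zero
  have hroot : ∀ x, p.eval x ≠ 0 := by
    intro x hx
    exact h1 (natDegree_eq_of_degree_eq_some
      (degree_eq_one_of_irreducible_of_root hp hx))
  have hdisc : p.coeff 1 ^ 2 - 4 * p.coeff 2 * p.coeff 0 < 0 := by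
    by_contra hd
    obtain ⟨s, hs⟩ := IsSquare.of_nonneg (not_lt.1 hd)
    refine hroot ((-p.coeff 1 + s) / (2 * p.coeff 2)) ?_
    rw [hev]
    field_simp
    linear_combination -hs
  have hpos : ∀ x, 0 < 4 * p.coeff 2 * p.eval x := by
    intro x
    have : 4 * p.coeff 2 * p.eval x =
        (2 * p.coeff 2 * x + p.coeff 1) ^ 2 - (p.coeff 1 ^ 2 - 4 * p.coeff 2 * p.coeff 0) := by
      rw [hev]; ring
    rw [this]
    nlinarith [sq_nonneg (2 * p.coeff 2 * x + p.coeff 1)]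
  have h3 := mul_pos (hpos a) (hpos b)
  have h4 : 4 * p.coeff 2 * p.eval a * (4 * p.coeff 2 * p.eval b) =
      (4 * p.coeff 2) ^ 2 * (p.eval a * p.eval b) := by ring
  rw [h4] at h3
  exact (pos_of_mul_pos_right h3 (sq_nonneg _)).le

/-- The intermediate value theorem for polynomials over a real closed field. -/
theorem exists_root_of_eval_mul_eval_neg {f : R[X]} {a b : R} (hab : a < b)
    (h : f.eval a * f.eval b < 0) : ∃ c, a < c ∧ c < b ∧ f.eval c = 0 := by
  -- If `p * g` changes sign, then `g` does, or else `p` does; in the latter case `p` is linear and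
  -- its root lies in the interval.
  induction f using WfDvdMonoid.induction_on_irreducible with
  | zero => simp at h
  | unit u hu =>
    obtain ⟨r, -, rfl⟩ := isUnit_iff.1 hu
    simp only [eval_C] at h
    exact absurd h (not_lt.2 (mul_self_nonneg r))
  | mul g p _ hp ih =>
    by_cases hg : g.eval a * g.eval b < 0
    · obtain ⟨c, h1, h2, h3⟩ := ih hg
      exact ⟨c, h1, h2, by simp [h3]⟩
    · have hpab : p.eval a * p.eval b < 0 := by
        by_contra hp'
        refine absurd h (not_lt.2 ?_)
        rw [eval_mul, eval_mul, mul_mul_mul_comm]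
        exact mul_nonneg (not_lt.1 hp') (not_lt.1 hg)
      have hd : p.natDegree = 1 := by
        by_contra hd
        exact absurd hpab (not_lt.2
          (mul_eval_nonneg_of_irreducible_of_natDegree_ne_one hp hd a b))
      obtain ⟨u, hu, v, rfl⟩ := natDegree_eq_one.1 hd
      simp only [eval_add, eval_mul, eval_C, eval_X] at hpab
      obtain ⟨c, rfl⟩ : ∃ c, v = -(u * c) := ⟨-v / u, by field_simp⟩
      have hc : (a - c) * (b - c) < 0 := by
        have e : (u * a + -(u * c)) * (u * b + -(u * c)) = u ^ 2 * ((a - c) * (b - c)) := by ring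
        rw [e] at hpab
        exact neg_of_mul_neg_right hpab (sq_nonneg u)
      rcases mul_neg_iff.1 hc with ⟨h1, h2⟩ | ⟨h1, h2⟩
      · linarith
      · exact ⟨c, by linarith, by linarith, by simp⟩

/-- Rolle's theorem. Between consecutive roots `a < b'` write `f = (X - a)^(m+1) (X - b')^(n+1) g`,
where `g` keeps its sign. Then `f' = (X - a)^m (X - b')^n h`, and `h` has opposite signs at `a` and
`b'`. -/
theorem exists_eval_derivative_eq_zero {f : R[X]} {a b : R} (hab : a < b)
    (ha : f.eval a = 0) (hb : f.eval b = 0) :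
    ∃ c, a < c ∧ c < b ∧ (derivative f).eval c = 0 := by
  by_cases hf : f = 0
  · obtain ⟨c, h1, h2⟩ := exists_between hab
    exact ⟨c, h1, h2, by simp [hf]⟩
  -- The least element of `S` is the first root after `a`, to which `b` is moved.
  let S := f.roots.toFinset.filter (fun x => a < x ∧ x ≤ b)
  have hS : ∀ x, x ∈ S ↔ f.eval x = 0 ∧ a < x ∧ x ≤ b := by
    intro x
    simp [S, hf]
  have hne : S.Nonempty := ⟨b, (hS b).2 ⟨hb, hab, le_rfl⟩⟩
  obtain ⟨hb', hab', hb'b⟩ := (hS _).1 (S.min'_mem hne)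
  have hmin : ∀ x, a < x → x < S.min' hne → f.eval x ≠ 0 := by
    intro x hx hxb hx0
    exact absurd (S.min'_le x ((hS x).2 ⟨hx0, hx, hxb.le.trans hb'b⟩)) (not_le.2 hxb)
  generalize S.min' hne = b' at *
  obtain ⟨g₁, hg₁, hg₁'⟩ := exists_eq_pow_rootMultiplicity_mul_and_not_dvd f hf a
  obtain ⟨m, hm⟩ : ∃ m, f.rootMultiplicity a = m + 1 :=
    Nat.exists_eq_succ_of_ne_zero ((rootMultiplicity_pos hf).2 ha).ne'
  rw [hm] at hg₁
  have hg₁0 : g₁ ≠ 0 := by rintro rfl; simp at hg₁'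
  have hg₁b : g₁.eval b' = 0 := by
    rw [hg₁, eval_mul, eval_pow, eval_sub, eval_X, eval_C] at hb'
    exact (mul_eq_zero.1 hb').resolve_left (pow_ne_zero _ (sub_ne_zero.2 hab'.ne'))
  obtain ⟨g, hg, hg'⟩ := exists_eq_pow_rootMultiplicity_mul_and_not_dvd g₁ hg₁0 b'
  obtain ⟨n, hn⟩ : ∃ n, g₁.rootMultiplicity b' = n + 1 :=
    Nat.exists_eq_succ_of_ne_zero ((rootMultiplicity_pos hg₁0).2 hg₁b).ne'
  rw [hn] at hg
  have hga : g.eval a ≠ 0 := fun h => hg₁' (by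
    rw [hg]; exact dvd_mul_of_dvd_right (dvd_iff_isRoot.2 h) _)
  have hgb : g.eval b' ≠ 0 := fun h => hg' (dvd_iff_isRoot.2 h)
  have hgpos : 0 < g.eval a * g.eval b' := by
    by_contra hneg
    obtain ⟨c, h1, h2, h3⟩ := exists_root_of_eval_mul_eval_neg hab'
      (lt_of_le_of_ne (not_lt.1 hneg) (mul_ne_zero hga hgb))
    exact hmin c h1 h2 (by rw [hg₁, hg]; simp [h3])
  let h : R[X] := C ((m : R) + 1) * (X - C b') * g + C ((n : R) + 1) * (X - C a) * g +
    (X - C a) * (X - C b') * derivative g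
  have hha : h.eval a = ((m : R) + 1) * (a - b') * g.eval a := by simp [h]
  have hhb : h.eval b' = ((n : R) + 1) * (b' - a) * g.eval b' := by simp [h]
  obtain ⟨c, h1, h2, h3⟩ := exists_root_of_eval_mul_eval_neg (f := h) hab' (by
    rw [hha, hhb]
    have e : ((m : R) + 1) * (a - b') * g.eval a * (((n : R) + 1) * (b' - a) * g.eval b') =
      -(((m : R) + 1) * ((n : R) + 1) * (b' - a) ^ 2 * (g.eval a * g.eval b')) := by ring
    rw [e, neg_lt_zero]
    have := sub_pos.2 hab'
    positivity)
  refine ⟨c, h1, h2.trans_le hb'b, ?_⟩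
  have hder : derivative f = (X - C a) ^ m * (X - C b') ^ n * h := by
    rw [hg₁, hg]
    simp only [derivative_mul, derivative_X_sub_C_pow, Nat.add_sub_cancel, h, map_add, map_one,
      Nat.cast_add, Nat.cast_one, map_natCast]
    ring
  rw [hder, eval_mul, h3, mul_zero]

theorem exists_eval_derivative_eq_slope (f : R[X]) {a b : R} (hab : a < b) :
    ∃ c, a < c ∧ c < b ∧ f.eval b - f.eval a = (derivative f).eval c * (b - a) := by
  obtain ⟨c, h1, h2, h3⟩ := exists_eval_derivative_eq_zero
    (f := C (b - a) * (f - C (f.eval a)) - C (f.eval b - f.eval a) * (X - C a)) hab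
    (by simp) (by simp; ring)
  refine ⟨c, h1, h2, ?_⟩
  simp only [map_sub, derivative_mul, derivative_C, derivative_X, eval_add, eval_sub, eval_mul,
    eval_C, eval_X] at h3
  simp at h3
  linear_combination -h3

end

end

section

open Polynomial

/-! ### Finite sets of polynomials closed under pseudo-remainders -/

section

variable {A : Type*} [CommRing A]

/-- `r` is a pseudo-remainder of `f` on division by `g`. -/
def IsPseudoRem (f g r : A[X]) : Prop :=
  r.natDegree < g.natDegree ∧ ∃ (n : ℕ) (q : A[X]), C (g.leadingCoeff ^ n) * f = q * g + r

/-- The leading coefficient of `g` need not be invertible, so `f` is multiplied by it before each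
cancellation of the top term. -/
theorem exists_isPseudoRem (f : A[X]) {g : A[X]} (hg : 0 < g.natDegree) :
    ∃ r, IsPseudoRem f g r := by
  induction hd : f.natDegree using Nat.strong_induction_on generalizing f with
  | _ d ih =>
    by_cases hlt : f.natDegree < g.natDegree
    · exact ⟨f, hlt, 0, 0, by simp⟩
    · let f' : A[X] := C g.leadingCoeff * f -
        C f.leadingCoeff * X ^ (f.natDegree - g.natDegree) * g
      have hf' : f'.natDegree < d := by
        have hle : f'.natDegree ≤ d := by
          refine (natDegree_sub_le _ _).trans (max_le ?_ ?_)
          · exact (natDegree_C_mul_le _ _).trans hd.le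
          · rw [mul_assoc]
            refine (natDegree_C_mul_le _ _).trans (natDegree_mul_le.trans ?_)
            have := natDegree_X_pow_le (R := A) (f.natDegree - g.natDegree)
            omega
        refine lt_of_le_of_ne hle fun h => ?_
        have h0 : f'.coeff d = 0 := by
          have e : d = g.natDegree + (f.natDegree - g.natDegree) := by omega
          have e2 : (C f.leadingCoeff * X ^ (f.natDegree - g.natDegree) * g).coeff d =
              f.leadingCoeff * g.leadingCoeff := by
            rw [mul_assoc, coeff_C_mul, e, coeff_X_pow_mul]; rfl
          rw [coeff_sub, e2, coeff_C_mul, ← hd]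
          simp only [leadingCoeff]; ring
        have : f' = 0 := by
          rw [← leadingCoeff_eq_zero, leadingCoeff, h, h0]
        rw [this, natDegree_zero] at h
        omega
      obtain ⟨r, hr, n, q, hq⟩ := ih _ hf' f' rfl
      refine ⟨r, hr, n + 1, q + C (g.leadingCoeff ^ n) *
        (C f.leadingCoeff * X ^ (f.natDegree - g.natDegree)), ?_⟩
      rw [pow_succ, C_mul]
      linear_combination hq

/-- `g` can be reduced in `U`: its derivative, its truncation, and pseudo-remainders by `g` of all
elements of `U` lie in `U`. -/
def Reducible (U : Finset A[X]) (g : A[X]) : Prop :=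
  derivative g ∈ U ∧ g.eraseLead ∈ U ∧ ∀ f ∈ U, ∃ r ∈ U, IsPseudoRem f g r

/-- Degrees are treated downwards. The polynomials adjoined for the elements of degree `d` all have
degree below `d`, so nothing new appears in the degrees already treated. Earlier reductions survive,
because a new `f` of smaller degree than `g` is its own pseudo-remainder. -/
theorem exists_forall_reducible_of_le (d : ℕ) (F : Finset A[X])
    (hF : ∀ g ∈ F, d ≤ g.natDegree → 0 < g.natDegree → Reducible F g) :
    ∃ U, F ⊆ U ∧ ∀ g ∈ U, 0 < g.natDegree → Reducible U g := by
  classical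
  induction d generalizing F with
  | zero => exact ⟨F, subset_rfl, fun g hg => hF g hg (Nat.zero_le _)⟩
  | succ d ih =>
    rcases Nat.eq_zero_or_pos d with rfl | hd
    · exact ih F fun g hg _ h => hF g hg h h
    choose! rem hrem using fun (g : A[X]) (hg : 0 < g.natDegree) (f : A[X]) =>
      exists_isPseudoRem f hg
    let N : A[X] → Finset A[X] := fun g => {derivative g, g.eraseLead} ∪ F.image (rem g)
    let F' := F ∪ (F.filter fun g => g.natDegree = d).biUnion N
    have hsub : F ⊆ F' := Finset.subset_union_left
    have hnew : ∀ f ∈ F', f ∈ F ∨ f.natDegree < d := by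
      intro f hf
      rcases Finset.mem_union.1 hf with hf | hf
      · exact Or.inl hf
      · right
        obtain ⟨g, hg, hfg⟩ := Finset.mem_biUnion.1 hf
        obtain ⟨-, hgd⟩ := Finset.mem_filter.1 hg
        simp only [N, Finset.mem_union, Finset.mem_insert, Finset.mem_singleton,
          Finset.mem_image] at hfg
        rcases hfg with (rfl | rfl) | ⟨f', -, rfl⟩
        · exact (natDegree_derivative_lt (by omega)).trans_eq hgd
        · have := eraseLead_natDegree_le g
          omega
        · exact (hrem g (by omega) f').1.trans_eq hgd
    obtain ⟨U, hU, hU'⟩ := ih F' (by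
      intro g hg hgd hg0
      have hgF : g ∈ F := (hnew g hg).resolve_right (by omega)
      rcases Nat.eq_or_lt_of_le hgd with hgd | hgd
      · have hN : N g ⊆ F' := fun x hx => Finset.mem_union_right _
          (Finset.mem_biUnion.2 ⟨g, Finset.mem_filter.2 ⟨hgF, hgd.symm⟩, hx⟩)
        refine ⟨hN (by simp [N]), hN (by simp [N]), fun f hf => ?_⟩
        rcases hnew f hf with hf' | hf'
        · exact ⟨rem g f, hN (Finset.mem_union_right _ (Finset.mem_image_of_mem _ hf')),
            hrem g hg0 f⟩
        · exact ⟨f, hf, by omega, 0, 0, by simp⟩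
      · obtain ⟨h1, h2, h3⟩ := hF g hgF hgd hg0
        refine ⟨hsub h1, hsub h2, fun f hf => ?_⟩
        rcases hnew f hf with hf' | hf'
        · obtain ⟨r, hr, hr'⟩ := h3 f hf'
          exact ⟨r, hsub hr, hr'⟩
        · exact ⟨f, hf, by omega, 0, 0, by simp⟩)
    exact ⟨U, hsub.trans hU, hU'⟩

theorem exists_forall_reducible (F : Finset A[X]) :
    ∃ U, F ⊆ U ∧ ∀ g ∈ U, 0 < g.natDegree → Reducible U g :=
  -- Above all degrees in `F` the starting hypothesis is vacuous.
  exists_forall_reducible_of_le (F.sup natDegree + 1) F fun g hg h _ => by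
    have := Finset.le_sup (f := natDegree) hg
    omega

end

/-! ### Corresponding positions in two ordered sets -/

section

variable {R S : Type*} [LinearOrder R] [LinearOrder S]

/-- `a` and `b` are in the same position relative to a set of pairs of corresponding points. -/
def SamePos (L : Set (R × S)) (a : R) (b : S) : Prop :=
  ∀ p ∈ L, (a < p.1 ↔ b < p.2) ∧ (p.1 < a ↔ p.2 < b)

theorem SamePos.eq_iff {L : Set (R × S)} {a : R} {b : S} (h : SamePos L a b) {p : R × S}
    (hp : p ∈ L) : a = p.1 ↔ b = p.2 := by
  obtain ⟨h1, h2⟩ := h p hp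
  constructor
  · intro e
    exact le_antisymm (not_lt.1 (h2.not.1 e.not_gt)) (not_lt.1 (h1.not.1 e.not_lt))
  · intro e
    exact le_antisymm (not_lt.1 (h2.not.2 e.not_gt)) (not_lt.1 (h1.not.2 e.not_lt))

theorem SamePos.mono {L L' : Set (R × S)} (h : L ⊆ L') {a : R} {b : S} (hab : SamePos L' a b) :
    SamePos L a b :=
  fun p hp => hab p (h hp)

theorem samePos_swap {L : Set (R × S)} {a : R} {b : S} :
    SamePos (Prod.swap ⁻¹' L) b a ↔ SamePos L a b :=
  ⟨fun h p hp => ⟨(h p.swap (by simpa)).1.symm, (h p.swap (by simpa)).2.symm⟩,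
    fun h p hp => ⟨(h p.swap hp).1.symm, (h p.swap hp).2.symm⟩⟩

theorem exists_samePos [DenselyOrdered S] [NoMinOrder S] [NoMaxOrder S] [Nonempty S]
    {L : Set (R × S)} (hfin : L.Finite)
    (hL : ∀ p ∈ L, SamePos L p.1 p.2) (a : R) : ∃ b, SamePos L a b := by
  classical
  by_cases ha : ∃ p ∈ L, p.1 = a
  · obtain ⟨p, hp, rfl⟩ := ha
    exact ⟨p.2, hL p hp⟩
  push Not at ha
  obtain ⟨b, h1, h2⟩ := Order.exists_between_finsets
    ((hfin.toFinset.filter fun p => p.1 < a).image Prod.snd)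
    ((hfin.toFinset.filter fun p => a < p.1).image Prod.snd) (by
      simp only [Finset.mem_image, Finset.mem_filter, Set.Finite.mem_toFinset]
      rintro _ ⟨p, ⟨hp, hpa⟩, rfl⟩ _ ⟨q, ⟨hq, hqa⟩, rfl⟩
      exact (hL p hp q hq).1.1 (hpa.trans hqa))
  simp only [Finset.mem_image, Finset.mem_filter, Set.Finite.mem_toFinset] at h1 h2
  refine ⟨b, fun p hp => ?_⟩
  rcases lt_or_gt_of_ne (ha p hp) with h | h
  · have := h1 _ ⟨p, ⟨hp, h⟩, rfl⟩
    exact ⟨iff_of_false h.not_gt this.not_gt, iff_of_true h this⟩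
  · have := h2 _ ⟨p, ⟨hp, h⟩, rfl⟩
    exact ⟨iff_of_true h this, iff_of_false h.not_gt this.not_gt⟩

/-- Take the nearest points of `L` on either side of `a`: with no point of `L` in between, the
position relative to `L` is constant on the cell. -/
theorem exists_cell {L : Set (R × S)} (hfin : L.Finite) (hL : ∀ p ∈ L, SamePos L p.1 p.2)
    {a : R} {b : S} (hab : SamePos L a b) (ha : ∀ p ∈ L, p.1 ≠ a)
    (hlo : ∃ p ∈ L, p.1 < a) (hhi : ∃ p ∈ L, a < p.1) :
    ∃ p ∈ L, ∃ q ∈ L, a ∈ Set.Ioo p.1 q.1 ∧ b ∈ Set.Ioo p.2 q.2 ∧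
      ∀ x ∈ Set.Ioo p.1 q.1, ∀ y ∈ Set.Ioo p.2 q.2, SamePos L x y := by
  obtain ⟨p, ⟨hp, hpa⟩, hpmax⟩ := Set.exists_max_image {p ∈ L | p.1 < a} Prod.fst
    (hfin.subset (Set.sep_subset _ _)) hlo
  obtain ⟨q, ⟨hq, hqa⟩, hqmin⟩ := Set.exists_min_image {p ∈ L | a < p.1} Prod.fst
    (hfin.subset (Set.sep_subset _ _)) hhi
  refine ⟨p, hp, q, hq, ⟨hpa, hqa⟩, ⟨(hab p hp).2.1 hpa, (hab q hq).1.1 hqa⟩, ?_⟩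
  intro x hx y hy t ht
  rcases lt_or_gt_of_ne (ha t ht) with h | h
  · have h1 : t.1 ≤ p.1 := hpmax t ⟨ht, h⟩
    have h2 : t.2 ≤ p.2 := not_lt.1 ((hL p hp t ht).1.not.1 h1.not_gt)
    have h3 := h1.trans_lt hx.1
    have h4 := h2.trans_lt hy.1
    exact ⟨iff_of_false h3.not_gt h4.not_gt, iff_of_true h3 h4⟩
  · have h1 : q.1 ≤ t.1 := hqmin t ⟨ht, h⟩
    have h2 : q.2 ≤ t.2 := not_lt.1 ((hL q hq t ht).2.not.1 h1.not_gt)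
    have h3 := hx.2.trans_le h1
    have h4 := hy.2.trans_le h2
    exact ⟨iff_of_true h3 h4, iff_of_false h3.not_gt h4.not_gt⟩

end

/-! ### Signs of polynomials on corresponding intervals -/

theorem eq_zero_of_eval_eq_zero_on_Ioo {R : Type*} [Field R] [LinearOrder R]
    [IsStrictOrderedRing R] {P : R[X]} {z z' : R} (hz : z < z')
    (h : ∀ x ∈ Set.Ioo z z', P.eval x = 0) : P = 0 :=
  eq_zero_of_infinite_isRoot P ((Set.Ioo_infinite hz).mono h)

section

variable {R S : Type*} [Field R] [LinearOrder R] [IsStrictOrderedRing R] [IsRealClosed R]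
  [Field S] [LinearOrder S] [IsStrictOrderedRing S] [IsRealClosed S]

theorem eval_lt_eval_of_derivative_pos {P : R[X]} {z z' : R}
    (h : ∀ x ∈ Set.Ioo z z', 0 < (derivative P).eval x) {x y : R} (hx : z ≤ x) (hxy : x < y)
    (hy : y ≤ z') : P.eval x < P.eval y := by
  obtain ⟨c, h1, h2, h3⟩ := exists_eval_derivative_eq_slope P hxy
  have := mul_pos (h c ⟨hx.trans_lt h1, h2.trans_le hy⟩) (sub_pos.2 hxy)
  rw [← h3] at this
  exact sub_pos.1 this

theorem sign_eval_eq_sign_sub {P : R[X]} {z z' : R}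
    (h : ∀ x ∈ Set.Ioo z z', 0 < (derivative P).eval x) {r x : R} (hr : r ∈ Set.Ioo z z')
    (hr0 : P.eval r = 0) (hx : x ∈ Set.Ioo z z') :
    SignType.sign (P.eval x) = SignType.sign (x - r) := by
  rcases lt_trichotomy x r with hlt | rfl | hlt
  · rw [sign_neg (sub_neg.2 hlt),
      sign_neg ((eval_lt_eval_of_derivative_pos h hx.1.le hlt hr.2.le).trans_eq hr0)]
  · rw [hr0, sub_self]
  · rw [sign_pos (sub_pos.2 hlt),
      sign_pos (hr0.symm.trans_lt (eval_lt_eval_of_derivative_pos h hr.1.le hlt hx.2.le))]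

/-- An increasing polynomial that is nonnegative at the left end or nonpositive at the right end has
constant sign inside. Otherwise it has a root `r` inside and its sign at `x` is that of `x - r`. The
signs at the ends put `P` and `Q` in the same case. -/
theorem sign_eval_eq_of_derivative_pos {P : R[X]} {Q : S[X]} {z z' : R} {w w' : S}
    (hP : ∀ x ∈ Set.Ioo z z', 0 < (derivative P).eval x)
    (hQ : ∀ y ∈ Set.Ioo w w', 0 < (derivative Q).eval y)
    (hl : SignType.sign (P.eval z) = SignType.sign (Q.eval w))
    (hr : SignType.sign (P.eval z') = SignType.sign (Q.eval w'))
    {x : R} {y : S} (hx : x ∈ Set.Ioo z z') (hy : y ∈ Set.Ioo w w')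
    (hxy : ∀ r ∈ Set.Ioo z z', ∀ s ∈ Set.Ioo w w', P.eval r = 0 → Q.eval s = 0 →
      SignType.sign (x - r) = SignType.sign (y - s)) :
    SignType.sign (P.eval x) = SignType.sign (Q.eval y) := by
  have hPx := eval_lt_eval_of_derivative_pos hP le_rfl hx.1 hx.2.le
  have hPx' := eval_lt_eval_of_derivative_pos hP hx.1.le hx.2 le_rfl
  have hQy := eval_lt_eval_of_derivative_pos hQ le_rfl hy.1 hy.2.le
  have hQy' := eval_lt_eval_of_derivative_pos hQ hy.1.le hy.2 le_rfl
  by_cases h1 : 0 ≤ P.eval z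
  · have h2 : 0 ≤ Q.eval w := by rwa [← sign_nonneg_iff, ← hl, sign_nonneg_iff]
    rw [sign_pos (h1.trans_lt hPx), sign_pos (h2.trans_lt hQy)]
  by_cases h2 : P.eval z' ≤ 0
  · have h3 : Q.eval w' ≤ 0 := by rwa [← sign_nonpos_iff, ← hr, sign_nonpos_iff]
    rw [sign_neg (hPx'.trans_le h2), sign_neg (hQy'.trans_le h3)]
  push Not at h1 h2
  have h3 : Q.eval w < 0 := by rwa [← sign_eq_neg_one_iff, ← hl, sign_eq_neg_one_iff]
  have h4 : 0 < Q.eval w' := by rwa [← sign_eq_one_iff, ← hr, sign_eq_one_iff]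
  obtain ⟨r, hr1, hr2, hr3⟩ := exists_root_of_eval_mul_eval_neg (f := P) (hx.1.trans hx.2)
    (mul_neg_of_neg_of_pos h1 h2)
  obtain ⟨s, hs1, hs2, hs3⟩ := exists_root_of_eval_mul_eval_neg (f := Q) (hy.1.trans hy.2)
    (mul_neg_of_neg_of_pos h3 h4)
  rw [sign_eval_eq_sign_sub hP ⟨hr1, hr2⟩ hr3 hx, sign_eval_eq_sign_sub hQ ⟨hs1, hs2⟩ hs3 hy]
  exact hxy r ⟨hr1, hr2⟩ s ⟨hs1, hs2⟩ hr3 hs3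

/-- The common sign of the derivatives is constant on the cell; it cannot be zero, as `P'` would
then vanish on an interval. The negative case reduces to the positive one by negating `P` and `Q`.
-/
theorem sign_eval_eq_of_sign_derivative_eq {P : R[X]} {Q : S[X]} {z z' : R} {w w' : S}
    (hP0 : derivative P ≠ 0)
    (hPQ : ∀ x ∈ Set.Ioo z z', ∀ y ∈ Set.Ioo w w',
      SignType.sign ((derivative P).eval x) = SignType.sign ((derivative Q).eval y))
    (hl : SignType.sign (P.eval z) = SignType.sign (Q.eval w))
    (hr : SignType.sign (P.eval z') = SignType.sign (Q.eval w'))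
    {x : R} {y : S} (hx : x ∈ Set.Ioo z z') (hy : y ∈ Set.Ioo w w')
    (hxy : ∀ r ∈ Set.Ioo z z', ∀ s ∈ Set.Ioo w w', P.eval r = 0 → Q.eval s = 0 →
      SignType.sign (x - r) = SignType.sign (y - s)) :
    SignType.sign (P.eval x) = SignType.sign (Q.eval y) := by
  rcases lt_trichotomy ((derivative Q).eval y) 0 with h | h | h
  · have h1 : ∀ x ∈ Set.Ioo z z', 0 < (derivative (-P)).eval x := fun x hx => by
      rw [derivative_neg, eval_neg, neg_pos, ← sign_eq_neg_one_iff, hPQ x hx y hy, sign_neg h]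
    have h2 : ∀ y ∈ Set.Ioo w w', 0 < (derivative (-Q)).eval y := fun y' hy' => by
      rw [derivative_neg, eval_neg, neg_pos, ← sign_eq_neg_one_iff, ← hPQ x hx y' hy',
        hPQ x hx y hy, sign_neg h]
    have := sign_eval_eq_of_derivative_pos h1 h2
      (by rw [eval_neg, eval_neg, Left.sign_neg, Left.sign_neg, hl])
      (by rw [eval_neg, eval_neg, Left.sign_neg, Left.sign_neg, hr]) hx hy
      (fun r hr s hs h1 h2 => hxy r hr s hs (by simpa using h1) (by simpa using h2))
    rwa [eval_neg, eval_neg, Left.sign_neg, Left.sign_neg, neg_inj] at this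
  · refine absurd (eq_zero_of_eval_eq_zero_on_Ioo (hx.1.trans hx.2) fun x hx => ?_) hP0
    rw [← sign_eq_zero_iff, hPQ x hx y hy, h, sign_zero]
  · have h1 : ∀ x ∈ Set.Ioo z z', 0 < (derivative P).eval x := fun x hx => by
      rw [← sign_eq_one_iff, hPQ x hx y hy, sign_pos h]
    have h2 : ∀ y ∈ Set.Ioo w w', 0 < (derivative Q).eval y := fun y' hy' => by
      rw [← sign_eq_one_iff, ← hPQ x hx y' hy', hPQ x hx y hy, sign_pos h]
    exact sign_eval_eq_of_derivative_pos h1 h2 hl hr hx hy hxy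

end

/-- If `s' ≤ s`, every point between `r` and `r'` is in the same position as `s`, so `P'` has one
sign there. By Rolle that sign is zero, which forces `P' = 0`. -/
theorem root_lt_root_of_samePos {R S : Type*} [Field R] [LinearOrder R] [IsStrictOrderedRing R]
    [IsRealClosed R] [Field S] [LinearOrder S] {L : Set (R × S)} {P : R[X]} {Q : S[X]}
    (hP0 : derivative P ≠ 0)
    (h : ∀ a b, SamePos L a b →
      SignType.sign ((derivative P).eval a) = SignType.sign ((derivative Q).eval b))
    {r r' : R} {s s' : S} (hrs : SamePos L r s) (hrs' : SamePos L r' s')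
    (hr : P.eval r = 0) (hr' : P.eval r' = 0) (hlt : r < r') : s < s' := by
  by_contra hs
  push Not at hs
  have hpos : ∀ c ∈ Set.Ioo r r', SamePos L c s := by
    intro c hc p hp
    obtain ⟨h1, h2⟩ := hrs p hp
    obtain ⟨h3, h4⟩ := hrs' p hp
    exact ⟨⟨fun h => h1.1 (hc.1.trans h), fun h => hc.2.trans (h3.2 (hs.trans_lt h))⟩,
      ⟨fun h => (h4.1 (h.trans hc.2)).trans_le hs, fun h => (h2.2 h).trans hc.1⟩⟩
  obtain ⟨c, hc1, hc2, hc⟩ := exists_eval_derivative_eq_zero hlt hr hr'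
  refine hP0 (eq_zero_of_eval_eq_zero_on_Ioo hlt fun x hx => ?_)
  rw [← sign_eq_zero_iff, h x s (hpos x hx), ← h c s (hpos c ⟨hc1, hc2⟩), hc, sign_zero]

end

section

open Polynomial

/-! ### Corresponding sign diagrams -/

theorem map_eq_map_eraseLead {A R : Type*} [CommRing A] [Field R] {f : A[X]}
    {φ : A →+* R} (h : φ f.leadingCoeff = 0) :
    f.map φ = f.eraseLead.map φ := by
  conv_lhs => rw [← eraseLead_add_C_mul_X_pow f]
  rw [Polynomial.map_add, Polynomial.map_mul, map_C, h, C_0, zero_mul, add_zero]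

/-- Truncating the polynomials whose leading coefficient vanishes, two sign functions agree on `U`
if they agree on constants and on polynomials whose leading coefficient does not vanish. -/
theorem sign_eval_map_eq_of_leadingCoeff {A R S : Type*} [CommRing A] [Field R]
    [LinearOrder R] [Field S] [LinearOrder S] {U : Finset A[X]}
    {φ : A →+* R} {ψ : A →+* S}
    (hU : ∀ g ∈ U, 0 < g.natDegree → g.eraseLead ∈ U)
    (hlc : ∀ g ∈ U, SignType.sign (φ g.leadingCoeff) = SignType.sign (ψ g.leadingCoeff))
    {a : R} {b : S}
    (h : ∀ g ∈ U, φ g.leadingCoeff ≠ 0 → ψ g.leadingCoeff ≠ 0 → 0 < g.natDegree →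
      SignType.sign ((g.map φ).eval a) = SignType.sign ((g.map ψ).eval b)) :
    ∀ g ∈ U, SignType.sign ((g.map φ).eval a) = SignType.sign ((g.map ψ).eval b) := by
  intro g hg
  induction hd : g.natDegree using Nat.strong_induction_on generalizing g with
  | _ d ih =>
    rcases Nat.eq_zero_or_pos g.natDegree with h0 | h0
    · have := hlc g hg
      rw [natDegree_eq_zero] at h0
      obtain ⟨c, rfl⟩ := h0
      simpa using this
    · by_cases hφ : φ g.leadingCoeff = 0
      · have hψ : ψ g.leadingCoeff = 0 := by
          rw [← sign_eq_zero_iff, ← hlc g hg, hφ, sign_zero]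
        rw [map_eq_map_eraseLead hφ, map_eq_map_eraseLead hψ]
        have := eraseLead_natDegree_le g
        exact ih _ (by omega) _ (hU g hg h0) rfl
      · have hψ : ψ g.leadingCoeff ≠ 0 := by
          rwa [Ne, ← sign_eq_zero_iff, ← hlc g hg, sign_eq_zero_iff]
        exact h g hg hφ hψ h0

section

variable {A R S : Type*} [CommRing A]
  [Field R] [LinearOrder R] [IsStrictOrderedRing R]
  [Field S] [LinearOrder S] [IsStrictOrderedRing S]

theorem exists_forall_sign_eval_map (U : Finset A[X]) (φ : A →+* R) :
    ∃ N M : R, N < M ∧ ∀ g ∈ U, φ g.leadingCoeff ≠ 0 →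
      (∀ x ≥ M, SignType.sign ((g.map φ).eval x) = SignType.sign (φ g.leadingCoeff)) ∧
      ∀ x ≤ N, SignType.sign ((g.map φ).eval x) =
        SignType.sign ((-1) ^ g.natDegree * φ g.leadingCoeff) := by
  classical
  induction U using Finset.induction_on with
  | empty => exact ⟨0, 1, one_pos, by simp⟩
  | insert f U _ ih =>
    obtain ⟨N, M, hNM, h⟩ := ih
    by_cases hf : φ f.leadingCoeff = 0
    · refine ⟨N, M, hNM, fun g hg hg0 => ?_⟩
      rcases Finset.mem_insert.1 hg with rfl | hg
      · exact absurd hf hg0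
      · exact h g hg hg0
    · have hne : f.map φ ≠ 0 := by
        intro h0
        apply hf
        rw [leadingCoeff, ← coeff_map, h0, coeff_zero]
      obtain ⟨M', hM'⟩ := exists_forall_ge_sign_eval hne
      obtain ⟨N', hN'⟩ := exists_forall_le_sign_eval hne
      rw [leadingCoeff_map_of_leadingCoeff_ne_zero φ hf] at hM' hN'
      rw [natDegree_map_of_leadingCoeff_ne_zero φ hf] at hN'
      refine ⟨min N N', max M M', (min_le_left _ _).trans_lt (hNM.trans_le (le_max_left _ _)),
        fun g hg hg0 => ?_⟩
      rcases Finset.mem_insert.1 hg with rfl | hg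
      · exact ⟨fun x hx => hM' x ((le_max_right _ _).trans hx),
          fun x hx => hN' x (hx.trans (min_le_right _ _))⟩
      · exact ⟨fun x hx => (h g hg hg0).1 x ((le_max_left _ _).trans hx),
          fun x hx => (h g hg hg0).2 x (hx.trans (min_le_left _ _))⟩

/-- The finite set `L` of pairs of corresponding points separates regions in which the signs of the
elements of `s` correspond; at the points of `L` the signs of all elements of `U` correspond. -/
structure Diagram (U : Finset A[X]) (φ : A →+* R) (ψ : A →+* S) (L : Set (R × S))
    (s : Finset A[X]) : Prop where
  finite : L.Finite
  samePos : ∀ p ∈ L, SamePos L p.1 p.2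
  sign_point : ∀ p ∈ L, ∀ g ∈ U,
    SignType.sign ((g.map φ).eval p.1) = SignType.sign ((g.map ψ).eval p.2)
  sign_low : ∃ p ∈ L, ∀ a ≤ p.1, ∀ b ≤ p.2, ∀ g ∈ U,
    SignType.sign ((g.map φ).eval a) = SignType.sign ((g.map ψ).eval b)
  sign_high : ∃ p ∈ L, ∀ a ≥ p.1, ∀ b ≥ p.2, ∀ g ∈ U,
    SignType.sign ((g.map φ).eval a) = SignType.sign ((g.map ψ).eval b)
  sign : ∀ a b, SamePos L a b → ∀ g ∈ s,
    SignType.sign ((g.map φ).eval a) = SignType.sign ((g.map ψ).eval b)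

theorem exists_diagram_empty {U : Finset A[X]} {φ : A →+* R} {ψ : A →+* S}
    (hU : ∀ g ∈ U, 0 < g.natDegree → g.eraseLead ∈ U)
    (hlc : ∀ g ∈ U, SignType.sign (φ g.leadingCoeff) = SignType.sign (ψ g.leadingCoeff)) :
    ∃ L, Diagram U φ ψ L ∅ := by
  obtain ⟨N, M, hNM, h⟩ := exists_forall_sign_eval_map U φ
  obtain ⟨N', M', hNM', h'⟩ := exists_forall_sign_eval_map U ψ
  have hlow : ∀ a ≤ N, ∀ b ≤ N', ∀ g ∈ U,
      SignType.sign ((g.map φ).eval a) = SignType.sign ((g.map ψ).eval b) :=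
    fun a ha b hb => sign_eval_map_eq_of_leadingCoeff hU hlc fun g hg hφ hψ _ => by
      rw [(h g hg hφ).2 a ha, (h' g hg hψ).2 b hb, sign_mul, sign_mul, hlc g hg]
      congr 1
      rcases Nat.even_or_odd g.natDegree with e | e <;> simp [e.neg_one_pow]
  have hhigh : ∀ a ≥ M, ∀ b ≥ M', ∀ g ∈ U,
      SignType.sign ((g.map φ).eval a) = SignType.sign ((g.map ψ).eval b) :=
    fun a ha b hb => sign_eval_map_eq_of_leadingCoeff hU hlc fun g hg hφ hψ _ => by
      rw [(h g hg hφ).1 a ha, (h' g hg hψ).1 b hb, hlc g hg]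
  -- Two pairs of sentinels: beyond them every sign is dictated by leading coefficients and parities
  -- of degrees.
  refine ⟨{(N, N'), (M, M')}, by simp, ?_, ?_, ?_, ?_, by simp⟩
  · rintro p (rfl | rfl) q (rfl | rfl) <;>
      simp [hNM, hNM', hNM.not_gt, hNM'.not_gt]
  · rintro p (rfl | rfl)
    · exact hlow _ le_rfl _ le_rfl
    · exact hhigh _ le_rfl _ le_rfl
  · exact ⟨(N, N'), by simp, hlow⟩
  · exact ⟨(M, M'), by simp, hhigh⟩

/-- At a root of `g` the division identity becomes `lc(g)^n f = r`, and the nonzero sign of the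
power cancels. -/
theorem sign_eval_map_eq_of_isPseudoRem {φ : A →+* R} {ψ : A →+* S} {f g r : A[X]}
    (hr : IsPseudoRem f g r)
    (hlc : SignType.sign (φ g.leadingCoeff) = SignType.sign (ψ g.leadingCoeff))
    (hφ : φ g.leadingCoeff ≠ 0) {a : R} {b : S}
    (ha : (g.map φ).eval a = 0) (hb : (g.map ψ).eval b = 0)
    (hs : SignType.sign ((r.map φ).eval a) = SignType.sign ((r.map ψ).eval b)) :
    SignType.sign ((f.map φ).eval a) = SignType.sign ((f.map ψ).eval b) := by
  obtain ⟨-, n, q, hq⟩ := hr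
  have h1 : φ g.leadingCoeff ^ n * (f.map φ).eval a = (r.map φ).eval a := by
    have := congrArg (fun p => (p.map φ).eval a) hq
    simpa [ha] using this
  have h2 : ψ g.leadingCoeff ^ n * (f.map ψ).eval b = (r.map ψ).eval b := by
    have := congrArg (fun p => (p.map ψ).eval b) hq
    simpa [hb] using this
  rw [← h1, ← h2, sign_mul, sign_mul, sign_pow, sign_pow, ← hlc] at hs
  exact mul_left_cancel₀ (pow_ne_zero _ (by rwa [Ne, sign_eq_zero_iff])) hs

theorem SamePos.sign_sub_eq {L : Set (R × S)} {a : R} {b : S} (hab : SamePos L a b) {r : R} {s : S}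
    (h : (r, s) ∈ L) : SignType.sign (a - r) = SignType.sign (b - s) := by
  obtain ⟨h1, h2⟩ := hab _ h
  rcases lt_trichotomy a r with hlt | rfl | hlt
  · rw [sign_neg (sub_neg.2 hlt), sign_neg (sub_neg.2 (h1.1 hlt))]
  · obtain rfl := (hab.eq_iff h).1 rfl
    simp
  · rw [sign_pos (sub_pos.2 hlt), sign_pos (sub_pos.2 (h2.1 hlt))]

/-- The new points are the pairs of corresponding roots of `f`. There the signs of `U` are
determined by pseudo-remainders by `f`, which have smaller degree and so already agree. On a bounded
cell of the old diagram the signs of the derivatives agree, and the sign of `f` depends only on the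
ends and on the position relative to its root, which the new points record. If `f` is constant or
its leading coefficient vanishes, no point is needed. -/
theorem Diagram.exists_insert [IsRealClosed R] [IsRealClosed S] [DecidableEq A[X]]
    {U s : Finset A[X]} {φ : A →+* R} {ψ : A →+* S} {L : Set (R × S)}
    (hU : ∀ g ∈ U, 0 < g.natDegree → Reducible U g)
    (hlc : ∀ g ∈ U, SignType.sign (φ g.leadingCoeff) = SignType.sign (ψ g.leadingCoeff))
    (D : Diagram U φ ψ L s) {f : A[X]} (hf : f ∈ U)
    (hs : ∀ g ∈ U, g.natDegree < f.natDegree → g ∈ s) :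
    ∃ L', Diagram U φ ψ L' (insert f s) := by
  rcases Nat.eq_zero_or_pos f.natDegree with h0 | h0
  · refine ⟨L, { D with sign := fun a b hab g hg => ?_ }⟩
    rcases Finset.mem_insert.1 hg with rfl | hg
    · have := hlc g hf
      rw [natDegree_eq_zero] at h0
      obtain ⟨c, rfl⟩ := h0
      simpa using this
    · exact D.sign a b hab g hg
  obtain ⟨hder, herase, hrem⟩ := hU f hf h0
  have hders : derivative f ∈ s := hs _ hder (natDegree_derivative_lt h0.ne')
  have herases : f.eraseLead ∈ s := hs _ herase (by have := eraseLead_natDegree_le f; omega)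
  by_cases hφ : φ f.leadingCoeff = 0
  · have hψ : ψ f.leadingCoeff = 0 := by
      rw [← sign_eq_zero_iff, ← hlc f hf, hφ, sign_zero]
    refine ⟨L, { D with sign := fun a b hab g hg => ?_ }⟩
    rcases Finset.mem_insert.1 hg with rfl | hg
    · rw [map_eq_map_eraseLead hφ, map_eq_map_eraseLead hψ]
      exact D.sign a b hab _ herases
    · exact D.sign a b hab g hg
  have hψ : ψ f.leadingCoeff ≠ 0 := by
    rwa [Ne, ← sign_eq_zero_iff, ← hlc f hf, sign_eq_zero_iff]
  have hφ' : derivative (f.map φ) ≠ 0 := by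
    refine fun h => h0.ne' ?_
    rw [← natDegree_map_of_leadingCoeff_ne_zero φ hφ]
    exact derivative_eq_zero.1 h
  have hψ' : derivative (f.map ψ) ≠ 0 := by
    refine fun h => h0.ne' ?_
    rw [← natDegree_map_of_leadingCoeff_ne_zero ψ hψ]
    exact derivative_eq_zero.1 h
  have hd : ∀ a b, SamePos L a b → SignType.sign ((derivative (f.map φ)).eval a) =
      SignType.sign ((derivative (f.map ψ)).eval b) := by
    intro a b hab
    rw [derivative_map, derivative_map]
    exact D.sign a b hab _ hders
  let Z : Set (R × S) :=
    {p | SamePos L p.1 p.2 ∧ (f.map φ).eval p.1 = 0 ∧ (f.map ψ).eval p.2 = 0}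
  have hZfin : Z.Finite := by
    have hφ0 : f.map φ ≠ 0 := fun h => hφ' (by rw [h, derivative_zero])
    have hψ0 : f.map ψ ≠ 0 := fun h => hψ' (by rw [h, derivative_zero])
    refine ((f.map φ).roots.toFinset.finite_toSet.prod
      (f.map ψ).roots.toFinset.finite_toSet).subset ?_
    rintro p ⟨-, h1, h2⟩
    simp [hφ0, hψ0, h1, h2]
  have hZ : ∀ p ∈ Z, ∀ q ∈ Z, p.1 < q.1 ↔ p.2 < q.2 := by
    rintro p ⟨h1, h2, h3⟩ q ⟨h4, h5, h6⟩
    refine ⟨fun h => root_lt_root_of_samePos hφ' hd h1 h4 h2 h5 h, fun h => ?_⟩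
    exact root_lt_root_of_samePos hψ' (L := Prod.swap ⁻¹' L)
      (fun b a hab => (hd a b (samePos_swap.1 hab)).symm)
      (samePos_swap.2 h1) (samePos_swap.2 h4) h3 h6 h
  have hpt : ∀ p ∈ L ∪ Z, ∀ g ∈ U,
      SignType.sign ((g.map φ).eval p.1) = SignType.sign ((g.map ψ).eval p.2) := by
    rintro p (hp | ⟨h1, h2, h3⟩) g hg
    · exact D.sign_point p hp g hg
    · obtain ⟨r, hrU, hr⟩ := hrem g hg
      exact sign_eval_map_eq_of_isPseudoRem hr (hlc f hf) hφ h2 h3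
        (D.sign _ _ h1 r (hs r hrU hr.1))
  have hpos : ∀ p ∈ L ∪ Z, SamePos (L ∪ Z) p.1 p.2 := by
    rintro p (hp | hp) q (hq | hq)
    · exact D.samePos p hp q hq
    · have := hq.1 p hp
      exact ⟨this.2, this.1⟩
    · exact hp.1 q hq
    · exact ⟨hZ p hp q hq, hZ q hq p hp⟩
  obtain ⟨lo, hlo, hlo'⟩ := D.sign_low
  obtain ⟨hi, hhi, hhi'⟩ := D.sign_high
  refine ⟨L ∪ Z, D.finite.union hZfin, hpos, hpt, ⟨lo, Or.inl hlo, hlo'⟩, ⟨hi, Or.inl hhi, hhi'⟩,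
    fun a b hab g hg => ?_⟩
  have habL : SamePos L a b := hab.mono Set.subset_union_left
  rcases Finset.mem_insert.1 hg with rfl | hg
  swap
  · exact D.sign a b habL g hg
  by_cases haL : ∃ p ∈ L, p.1 = a
  · obtain ⟨p, hp, rfl⟩ := haL
    obtain rfl := (habL.eq_iff hp).1 rfl
    exact D.sign_point p hp g hf
  by_cases h1 : a ≤ lo.1
  · exact hlo' a h1 b (not_lt.1 ((habL lo hlo).2.not.1 h1.not_gt)) g hf
  by_cases h2 : hi.1 ≤ a
  · exact hhi' a h2 b (not_lt.1 ((habL hi hhi).1.not.1 h2.not_gt)) g hf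
  push Not at haL h1 h2
  -- What remains is a point strictly between the sentinels and not in `L`, so it lies in a bounded
  -- cell.
  obtain ⟨p, hp, q, hq, ha, hb, hcell⟩ := exists_cell D.finite D.samePos habL haL
    ⟨lo, hlo, h1⟩ ⟨hi, hhi, h2⟩
  exact sign_eval_eq_of_sign_derivative_eq hφ' (fun x hx y hy => hd x y (hcell x hx y hy))
    (D.sign_point p hp g hf) (D.sign_point q hq g hf) ha hb
    fun r hr t ht hr0 ht0 => hab.sign_sub_eq (Or.inr ⟨hcell r hr t ht, hr0, ht0⟩)

theorem exists_diagram [IsRealClosed R] [IsRealClosed S]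
    {U : Finset A[X]} {φ : A →+* R} {ψ : A →+* S}
    (hU : ∀ g ∈ U, 0 < g.natDegree → Reducible U g)
    (hlc : ∀ g ∈ U, SignType.sign (φ g.leadingCoeff) = SignType.sign (ψ g.leadingCoeff)) :
    ∃ L, Diagram U φ ψ L U := by
  classical
  suffices h : ∀ s ⊆ U, (∀ g ∈ U, ∀ f ∈ s, g.natDegree < f.natDegree → g ∈ s) →
      ∃ L, Diagram U φ ψ L s from
    h U subset_rfl fun g hg _ _ _ => hg
  intro s
  -- Insertion by increasing degree, so that derivatives, truncations and remainders are already in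
  -- the diagram when needed.
  induction s using Finset.induction_on_max_value (fun g : A[X] => g.natDegree) with
  | empty => exact fun _ _ => exists_diagram_empty (fun g hg h => (hU g hg h).2.1) hlc
  | insert f s hfs hmax ih =>
    intro hsU hs
    obtain ⟨L, D⟩ := ih ((Finset.subset_insert _ _).trans hsU) fun g hg t ht hgt =>
      (Finset.mem_insert.1 (hs g hg t (Finset.mem_insert_of_mem ht) hgt)).resolve_left
        fun h => absurd (hmax t ht) (not_le.2 (h ▸ hgt))
    exact D.exists_insert hU hlc (hsU (Finset.mem_insert_self _ _)) fun g hg hgf =>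
      (Finset.mem_insert.1 (hs g hg f (Finset.mem_insert_self _ _) hgf)).resolve_left
        fun h => absurd hgf (h ▸ lt_irrefl _)

end

/-- For every finite set `F` of polynomials in one variable there is a finite set `G` of parameters
such that, if the signs of `G` in two real closed fields agree, then every sign pattern of `F` taken
in one of them is taken in the other. -/
theorem exists_finset_forall_exists_sign_eq {A : Type*} [CommRing A] (F : Finset A[X]) :
    ∃ G : Finset A, ∀ {R S : Type} [Field R] [LinearOrder R] [IsStrictOrderedRing R]
      [IsRealClosed R] [Field S] [LinearOrder S] [IsStrictOrderedRing S] [IsRealClosed S]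
      (φ : A →+* R) (ψ : A →+* S),
      (∀ c ∈ G, SignType.sign (φ c) = SignType.sign (ψ c)) →
      ∀ a : R, ∃ b : S, ∀ g ∈ F,
        SignType.sign ((g.map φ).eval a) = SignType.sign ((g.map ψ).eval b) := by
  classical
  obtain ⟨U, hFU, hU⟩ := exists_forall_reducible F
  -- Truncations belong to `U`, so these leading coefficients include those that take over when a
  -- higher one vanishes.
  refine ⟨U.image leadingCoeff, fun φ ψ h a => ?_⟩
  obtain ⟨L, D⟩ := exists_diagram (φ := φ) (ψ := ψ) hU
    fun g hg => h _ (Finset.mem_image_of_mem _ hg)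
  obtain ⟨b, hb⟩ := exists_samePos D.finite D.samePos a
  exact ⟨b, fun g hg => D.sign a b hb g (hFU hg)⟩

end

/-! ### The transfer principle -/

section

variable {ι : Type*}

/-- Two valuations give the same sign to every polynomial in `G`. -/
def SignEquiv {R S : Type} [Field R] [LinearOrder R] [Field S] [LinearOrder S]
    (G : Finset (MvPolynomial ι ℤ)) (v : ι → R) (w : ι → S) : Prop :=
  ∀ p ∈ G, SignType.sign (MvPolynomial.aeval v p) = SignType.sign (MvPolynomial.aeval w p)

/-- Reads the variable `i` as a polynomial indeterminate over the ring of parameters. -/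
noncomputable def isolate [DecidableEq ι] (i : ι) :
    MvPolynomial ι ℤ →ₐ[ℤ] Polynomial (MvPolynomial ι ℤ) :=
  MvPolynomial.aeval fun j => if j = i then Polynomial.X else Polynomial.C (MvPolynomial.X j)

theorem eval_map_isolate [DecidableEq ι] {R : Type} [Field R] (i : ι) (v : ι → R) (a : R)
    (p : MvPolynomial ι ℤ) :
    ((isolate i p).map (MvPolynomial.aeval v : MvPolynomial ι ℤ →ₐ[ℤ] R).toRingHom).eval a =
      MvPolynomial.aeval (Function.update v i a) p := by
  induction p using MvPolynomial.induction_on with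
  | C c => simp [isolate]
  | add p q hp hq => simp only [map_add, Polynomial.map_add, Polynomial.eval_add, hp, hq]
  | mul_X p j hp =>
    simp only [map_mul, Polynomial.map_mul, Polynomial.eval_mul, hp]
    congr 1
    by_cases h : j = i
    · subst h; simp [isolate]
    · simp [isolate, h]

theorem exists_finset_forall_exists_signEquiv [DecidableEq ι] (F : Finset (MvPolynomial ι ℤ))
    (i : ι) :
    ∃ G : Finset (MvPolynomial ι ℤ), ∀ {R S : Type} [Field R] [LinearOrder R]
      [IsStrictOrderedRing R] [IsRealClosed R] [Field S] [LinearOrder S] [IsStrictOrderedRing S]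
      [IsRealClosed S] (v : ι → R) (w : ι → S), SignEquiv G v w →
      ∀ a : R, ∃ b : S, SignEquiv F (Function.update v i a) (Function.update w i b) := by
  classical
  obtain ⟨G, hG⟩ := exists_finset_forall_exists_sign_eq (F.image (isolate i))
  refine ⟨G, fun {R S} _ _ _ _ _ _ _ _ v w h a => ?_⟩
  obtain ⟨b, hb⟩ := hG (MvPolynomial.aeval v : MvPolynomial ι ℤ →ₐ[ℤ] R).toRingHom
    (MvPolynomial.aeval w : MvPolynomial ι ℤ →ₐ[ℤ] S).toRingHom h a
  refine ⟨b, fun p hp => ?_⟩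
  rw [← eval_map_isolate, ← eval_map_isolate]
  exact hb _ (Finset.mem_image_of_mem _ hp)

theorem sign_intCast_eq {R S : Type} [Field R] [LinearOrder R] [IsStrictOrderedRing R]
    [Field S] [LinearOrder S] [IsStrictOrderedRing S] (c : ℤ) :
    SignType.sign (c : R) = SignType.sign (c : S) := by
  rcases lt_trichotomy c 0 with h | rfl | h
  · rw [sign_neg (Int.cast_lt_zero.2 h), sign_neg (Int.cast_lt_zero.2 h)]
  · simp
  · rw [sign_pos (Int.cast_pos.2 h), sign_pos (Int.cast_pos.2 h)]

/-- Only finitely many variables occur; the others may be set to zero. Eliminating the remaining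
ones one by one leaves integer constants, whose signs are the same in all ordered fields. -/
theorem exists_signEquiv {R S : Type} [Field R] [LinearOrder R] [IsStrictOrderedRing R]
    [IsRealClosed R] [Field S] [LinearOrder S] [IsStrictOrderedRing S] [IsRealClosed S]
    (G : Finset (MvPolynomial ι ℤ)) (v : ι → R) : ∃ w : ι → S, SignEquiv G v w := by
  classical
  have key : ∀ (V : Finset ι) (G : Finset (MvPolynomial ι ℤ)) (v : ι → R),
      (∀ i ∉ V, v i = 0) → ∃ w : ι → S, SignEquiv G v w := by
    intro V
    induction V using Finset.induction_on with
    | empty =>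
      intro G v hv
      obtain rfl : v = fun _ => 0 := funext fun i => hv i (Finset.notMem_empty i)
      refine ⟨fun _ => 0, fun p _ => ?_⟩
      have h1 : MvPolynomial.aeval (fun _ : ι => (0 : R)) p =
          ((MvPolynomial.constantCoeff p : ℤ) : R) := by
        simp [MvPolynomial.aeval_def]
      have h2 : MvPolynomial.aeval (fun _ : ι => (0 : S)) p =
          ((MvPolynomial.constantCoeff p : ℤ) : S) := by
        simp [MvPolynomial.aeval_def]
      rw [h1, h2]
      exact sign_intCast_eq _
    | insert i V _ ih =>
      intro F v hv
      obtain ⟨G, hG⟩ := exists_finset_forall_exists_signEquiv F i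
      obtain ⟨w, hw⟩ := ih G (Function.update v i 0) fun j hj => by
        by_cases h : j = i
        · subst h; simp
        · rw [Function.update_of_ne h]
          exact hv j (by simp [h, hj])
      obtain ⟨b, hb⟩ := hG _ _ hw (v i)
      rw [Function.update_idem, Function.update_eq_self] at hb
      exact ⟨_, hb⟩
  obtain ⟨w, hw⟩ := key (G.biUnion MvPolynomial.vars) G
    (fun i => if i ∈ G.biUnion MvPolynomial.vars then v i else 0) (by simp +contextual)
  refine ⟨w, fun p hp => ?_⟩
  rw [← hw p hp]
  congr 1
  refine MvPolynomial.eval₂Hom_congr' rfl (fun i hi _ => ?_) rfl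
  rw [if_pos (Finset.mem_biUnion.2 ⟨p, hp, hi⟩)]

end

/-! ### Truth of formulas as a matter of signs of polynomials. -/

section

variable {m k : ℕ}

/-- A product as a polynomial in the variables and the basic terms. -/
noncomputable def Mono.toMvPolynomial : Mono m k → MvPolynomial (ℕ ⊕ Basic m k) ℤ
  | int a => MvPolynomial.C a
  | basic b => MvPolynomial.X (Sum.inr b)
  | var x => MvPolynomial.X (Sum.inl x)
  | mul t₁ t₂ => t₁.toMvPolynomial * t₂.toMvPolynomial

/-- A polynomial term as a polynomial in the variables and the basic terms. -/
noncomputable def Poly.toMvPolynomial : Poly m k → MvPolynomial (ℕ ⊕ Basic m k) ℤ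
  | mono t => t.toMvPolynomial
  | add p₁ p₂ => p₁.toMvPolynomial + p₂.toMvPolynomial

/-- Truth of a formula in an ordered field, where no primitive proposition is true and the valuation
gives values to the variables and to the basic terms. -/
def FieldSat {R : Type} [Field R] [LinearOrder R] (v : ℕ ⊕ Basic m k → R) (φ : Form m k) : Prop :=
  (FOStr.ofField (v ∘ Sum.inr) (fun _ => False) (fun _ => False)).Sat (v ∘ Sum.inl) φ

theorem aeval_toMvPolynomial {R : Type} [Field R] [LinearOrder R] (v : ℕ ⊕ Basic m k → R)
    (hy : Fin (m + 1) → Prop) (ob : Fin (k + 1) → Prop) (p : Poly m k) :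
    MvPolynomial.aeval v p.toMvPolynomial =
      (FOStr.ofField (v ∘ Sum.inr) hy ob).val (v ∘ Sum.inl) p := by
  have hmono : ∀ t : Mono m k, MvPolynomial.aeval v t.toMvPolynomial =
      (FOStr.ofField (v ∘ Sum.inr) hy ob).valMono (v ∘ Sum.inl) t := by
    intro t
    induction t with
    | int a => simp [Mono.toMvPolynomial, FOStr.valMono, FOStr.ofField]
    | basic b => simp [Mono.toMvPolynomial, FOStr.valMono, FOStr.ofField]
    | var x => simp [Mono.toMvPolynomial, FOStr.valMono]
    | mul t₁ t₂ h₁ h₂ => rw [Mono.toMvPolynomial, map_mul, h₁, h₂]; rfl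
  induction p with
  | mono t => exact hmono t
  | add p q hp hq => rw [Poly.toMvPolynomial, map_add, hp, hq]; rfl

theorem fieldSat_all_iff {R : Type} [Field R] [LinearOrder R] (v : ℕ ⊕ Basic m k → R) (x : ℕ)
    (φ : Form m k) [DecidableEq (ℕ ⊕ Basic m k)] :
    FieldSat v (Form.all x φ) ↔ ∀ a, FieldSat (Function.update v (Sum.inl x) a) φ := by
  refine forall_congr' fun a => ?_
  have h1 : Function.update v (Sum.inl x) a ∘ Sum.inr = v ∘ Sum.inr := by
    ext b; simp
  have h2 : Function.update v (Sum.inl x) a ∘ Sum.inl = Function.update (v ∘ Sum.inl) x a := by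
    ext y
    by_cases h : y = x
    · subst h; simp
    · simp [h]
  rw [FieldSat, h1, h2]

/-- Truth of a formula in a real closed field depends only on the signs of finitely many
polynomials. -/
theorem exists_finset_forall_fieldSat_iff (φ : Form m k) (hφ : φ.PropFree) :
    ∃ G : Finset (MvPolynomial (ℕ ⊕ Basic m k) ℤ), ∀ {R S : Type} [Field R] [LinearOrder R]
      [IsStrictOrderedRing R] [IsRealClosed R] [Field S] [LinearOrder S] [IsStrictOrderedRing S]
      [IsRealClosed S] (v : ℕ ⊕ Basic m k → R) (w : ℕ ⊕ Basic m k → S), SignEquiv G v w →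
      (FieldSat v φ ↔ FieldSat w φ) := by
  classical
  induction φ with
  | hyp h => exact hφ.elim
  | obs o => exact hφ.elim
  | ge p c =>
    refine ⟨{p.toMvPolynomial - MvPolynomial.C c}, fun {R S} _ _ _ _ _ _ _ _ v w h => ?_⟩
    have h1 := h _ (Finset.mem_singleton_self _)
    have h2 : ∀ {T : Type} [Field T] [LinearOrder T] [IsStrictOrderedRing T]
        (u : ℕ ⊕ Basic m k → T), FieldSat u (Form.ge p c) ↔
        0 ≤ SignType.sign (MvPolynomial.aeval u (p.toMvPolynomial - MvPolynomial.C c)) := by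
      intro T _ _ _ u
      rw [sign_nonneg_iff, map_sub, sub_nonneg, aeval_toMvPolynomial]
      simp only [MvPolynomial.aeval_C]
      rfl
    rw [h2, h2, h1]
  | neg φ ih =>
    obtain ⟨G, hG⟩ := ih hφ
    exact ⟨G, fun v w h => not_congr (hG v w h)⟩
  | and φ ψ ih₁ ih₂ =>
    obtain ⟨G₁, h₁⟩ := ih₁ hφ.1
    obtain ⟨G₂, h₂⟩ := ih₂ hφ.2
    exact ⟨G₁ ∪ G₂, fun v w h => and_congr
      (h₁ v w fun p hp => h p (Finset.mem_union_left _ hp))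
      (h₂ v w fun p hp => h p (Finset.mem_union_right _ hp))⟩
  | all x φ ih =>
    obtain ⟨F, hF⟩ := ih hφ
    -- Back and forth: sign equivalence for `G` lets any value of the quantified variable, on either
    -- side, be matched on the other.
    obtain ⟨G, hG⟩ := exists_finset_forall_exists_signEquiv F (Sum.inl x)
    refine ⟨G, fun v w h => ?_⟩
    rw [fieldSat_all_iff, fieldSat_all_iff]
    constructor
    · intro hv b
      obtain ⟨a, ha⟩ := hG w v (fun p hp => (h p hp).symm) b
      exact (hF _ _ ha).2 (hv a)
    · intro hw a
      obtain ⟨b, hb⟩ := hG v w h a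
      exact (hF _ _ hb).2 (hw b)

/-- Transfer from the reals to all real closed fields. -/
theorem isRCF_of_forall_real {φ : Form m k} (hφ : φ.PropFree)
    (h : ∀ (b : Basic m k → ℝ) (v : ℕ → ℝ),
      (FOStr.ofField b (fun _ => False) (fun _ => False)).Sat v φ) : IsRCF φ := by
  refine ⟨hφ, fun R _ _ _ _ b v => ?_⟩
  obtain ⟨G, hG⟩ := exists_finset_forall_fieldSat_iff φ hφ
  obtain ⟨w, hw⟩ := exists_signEquiv (S := ℝ) G (Sum.elim v b)
  exact (hG _ _ hw).2 (h _ _)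

end

/-! ### Semantics of the abbreviations -/

namespace FOStr

variable {m k : ℕ}

section

variable {D : Type} (M : FOStr m k D) (v : ℕ → D)

theorem sat_neg_iff (φ : Form m k) : M.Sat v φ.neg ↔ ¬ M.Sat v φ := Iff.rfl

theorem sat_and_iff (φ ψ : Form m k) : M.Sat v (φ.and ψ) ↔ M.Sat v φ ∧ M.Sat v ψ := Iff.rfl

theorem sat_or_iff (φ ψ : Form m k) : M.Sat v (φ.or ψ) ↔ M.Sat v φ ∨ M.Sat v ψ := by
  simp only [Form.or, sat_neg_iff, sat_and_iff]
  tauto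

theorem sat_imp_iff (φ ψ : Form m k) : M.Sat v (φ.imp ψ) ↔ (M.Sat v φ → M.Sat v ψ) := by
  simp only [Form.imp, sat_or_iff, sat_neg_iff]
  tauto

theorem sat_ex_iff (x : ℕ) (φ : Form m k) :
    M.Sat v (φ.ex x) ↔ ∃ a, M.Sat (Function.update v x a) φ := by
  simp only [Form.ex, Sat, not_forall, not_not]

theorem sat_conj_iff (n : ℕ) (f : Fin (n + 1) → Form m k) :
    M.Sat v (Form.conj n f) ↔ ∀ i, M.Sat v (f i) := by
  induction n with
  | zero => simp [Form.conj, Fin.forall_fin_one]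
  | succ n ih => rw [Form.conj, sat_and_iff, ih, Fin.forall_fin_succ' (n := n + 1)]

theorem sat_disj_iff (n : ℕ) (f : Fin (n + 1) → Form m k) :
    M.Sat v (Form.disj n f) ↔ ∃ i, M.Sat v (f i) := by
  induction n with
  | zero => simp [Form.disj, Fin.exists_fin_one]
  | succ n ih => rw [Form.disj, sat_or_iff, ih, Fin.exists_fin_succ' (n := n + 1)]

theorem sat_exs_iff (n : ℕ) (φ : Form m k) :
    M.Sat v (Form.exs n φ) ↔ ∃ w : ℕ → D, (∀ i, n ≤ i → w i = v i) ∧ M.Sat w φ := by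
  induction n generalizing φ with
  | zero =>
    refine ⟨fun h => ⟨v, fun _ _ => rfl, h⟩, ?_⟩
    rintro ⟨w, hw, h⟩
    obtain rfl : w = v := funext fun i => hw i (Nat.zero_le i)
    exact h
  | succ n ih =>
    rw [Form.exs, ih]
    simp only [sat_ex_iff]
    constructor
    · rintro ⟨w, hw, a, h⟩
      refine ⟨_, fun i hi => ?_, h⟩
      rw [Function.update_of_ne (by omega)]
      exact hw i (by omega)
    · rintro ⟨w, hw, h⟩
      refine ⟨Function.update w n (v n), fun i hi => ?_, w n, ?_⟩
      · by_cases hin : i = n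
        · subst hin; simp
        · rw [Function.update_of_ne hin]
          exact hw i (by omega)
      · rwa [Function.update_idem, Function.update_eq_self]

end

section

variable {R : Type} [Field R] [LinearOrder R]
  (b : Basic m k → R) (hy : Fin (m + 1) → Prop) (ob : Fin (k + 1) → Prop) (v : ℕ → R)

theorem val_neg (p : Poly m k) : (ofField b hy ob).val v p.neg = -(ofField b hy ob).val v p := by
  induction p with
  | mono t => simp [Poly.neg, val, valMono, ofField]
  | add p q hp hq =>
    rw [Poly.neg, val, hp, hq, val]
    exact (neg_add _ _).symm

theorem val_add (p q : Poly m k) :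
    (ofField b hy ob).val v (p.add q) = (ofField b hy ob).val v p + (ofField b hy ob).val v q :=
  rfl

theorem val_sub (p q : Poly m k) :
    (ofField b hy ob).val v (p.sub q) = (ofField b hy ob).val v p - (ofField b hy ob).val v q := by
  rw [Poly.sub, val_add, val_neg, sub_eq_add_neg]

theorem val_sum (n : ℕ) (f : Fin (n + 1) → Poly m k) :
    (ofField b hy ob).val v (Poly.sum n f) = ∑ i, (ofField b hy ob).val v (f i) := by
  induction n with
  | zero => simp [Poly.sum]
  | succ n ih => rw [Poly.sum, val_add, ih, Fin.sum_univ_castSucc (n := n + 1)]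

theorem val_basic (β : Basic m k) : (ofField b hy ob).val v (Poly.basic β) = b β := rfl

theorem sat_ge_iff (p : Poly m k) (c : ℤ) :
    (ofField b hy ob).Sat v (Form.ge p c) ↔ (c : R) ≤ (ofField b hy ob).val v p := Iff.rfl

theorem sat_propFree_iff {φ : Form m k} (hφ : φ.PropFree) (hy' : Fin (m + 1) → Prop)
    (ob' : Fin (k + 1) → Prop) :
    (ofField b hy ob).Sat v φ ↔ (ofField b hy' ob').Sat v φ := by
  induction φ generalizing v with
  | hyp h => exact hφ.elim
  | obs o => exact hφ.elim
  | ge p c =>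
    have h1 := aeval_toMvPolynomial (Sum.elim v b) hy ob p
    have h2 := aeval_toMvPolynomial (Sum.elim v b) hy' ob' p
    rw [h1] at h2
    rw [sat_ge_iff, sat_ge_iff]
    exact iff_of_eq (congrArg (fun x => (c : R) ≤ x) h2)
  | neg φ ih => exact not_congr (ih v hφ)
  | and φ ψ h₁ h₂ => exact and_congr (h₁ v hφ.1) (h₂ v hφ.2)
  | all x φ ih => exact forall_congr' fun a => ih _ hφ

variable [IsStrictOrderedRing R]

theorem sat_le_iff (p : Poly m k) (c : ℤ) :
    (ofField b hy ob).Sat v (Form.le p c) ↔ (ofField b hy ob).val v p ≤ c := by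
  rw [Form.le, sat_ge_iff, val_neg, Int.cast_neg, neg_le_neg_iff]

theorem sat_gt_iff (p : Poly m k) (c : ℤ) :
    (ofField b hy ob).Sat v (Form.gt p c) ↔ (c : R) < (ofField b hy ob).val v p := by
  rw [Form.gt, sat_neg_iff, sat_le_iff, not_le]

theorem sat_eqInt_iff (p : Poly m k) (c : ℤ) :
    (ofField b hy ob).Sat v (Form.eqInt p c) ↔ (ofField b hy ob).val v p = c := by
  rw [Form.eqInt, sat_and_iff, sat_le_iff, sat_ge_iff, le_antisymm_iff, and_comm]

theorem sat_eq_iff (p q : Poly m k) :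
    (ofField b hy ob).Sat v (Form.eq p q) ↔
      (ofField b hy ob).val v p = (ofField b hy ob).val v q := by
  rw [Form.eq, sat_eqInt_iff, val_sub, Int.cast_zero, sub_eq_zero]

theorem normal_ofField : (ofField b hy ob).Normal := fun v => by
  rw [sat_eq_iff]
  rfl

theorem sat_axiomE4_iff : (ofField b hy ob).Sat v (axiomE4 m k) ↔
    ∃ x : Fin (k + 1) → R, (∀ i, 0 < x i) ∧ ∀ j, ∑ i, b (Basic.weight i j) * x i = 1 := by
  rw [axiomE4, sat_exs_iff]
  simp only [sat_and_iff, sat_conj_iff, sat_gt_iff, sat_eqInt_iff, val_sum, Int.cast_zero,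
    Int.cast_one]
  constructor
  · rintro ⟨w, -, h1, h2⟩
    exact ⟨fun i => w i, h1, h2⟩
  · rintro ⟨x, h1, h2⟩
    let w : ℕ → R := fun n => if h : n < k + 1 then x ⟨n, h⟩ else v n
    have hw : ∀ i : Fin (k + 1), w i = x i := fun i => dif_pos i.2
    refine ⟨w, fun i hi => dif_neg (by omega), fun i => ?_, fun j => ?_⟩
    · exact (h1 i).trans_eq (hw i).symm
    · rw [← h2 j]
      exact Finset.sum_congr rfl fun i _ => congrArg (b (Basic.weight i j) * ·) (hw i)

end

end FOStr

/-! ### Soundness -/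

section

variable {m k : ℕ}

theorem HypForm.holds_iff {t : Fin (m + 1) → Prop} {i : Fin (m + 1)} (hi : t i)
    (ht : ∀ i j, i ≠ j → t i → ¬ t j) (ρ : HypForm m) : ρ.Holds t ↔ i ∈ ρ.intension := by
  induction ρ with
  | prim h =>
    rw [HypForm.Holds, HypForm.intension, Finset.mem_singleton]
    refine ⟨fun h' => ?_, fun h' => h' ▸ hi⟩
    by_contra hne
    exact ht i h hne hi h'
  | neg ρ ih => simp [HypForm.Holds, HypForm.intension, ih]
  | and ρ₁ ρ₂ h₁ h₂ => simp [HypForm.Holds, HypForm.intension, h₁, h₂]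

/-- An assignment that satisfies H1 and H2 amounts to the choice of one hypothesis. -/
theorem HypForm.tautEquiv_iff {ρ₁ ρ₂ : HypForm m} :
    ρ₁.TautEquiv ρ₂ ↔ ρ₁.intension = ρ₂.intension := by
  constructor
  · intro h
    ext i
    have ht : ∀ j l : Fin (m + 1), j ≠ l → j = i → ¬ l = i :=
      fun j l hjl hj hl => hjl (hj.trans hl.symm)
    have := h (fun j => j = i) ⟨i, rfl⟩ ht
    rwa [HypForm.holds_iff (t := fun j => j = i) rfl ht,
      HypForm.holds_iff (t := fun j => j = i) rfl ht] at this
  · rintro h t ⟨i, hi⟩ ht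
    rw [HypForm.holds_iff hi ht, HypForm.holds_iff hi ht, h]

theorem HypForm.intension_tru : (HypForm.tru m).intension = Finset.univ := by
  simp [HypForm.tru, HypForm.or, HypForm.intension]

theorem sum_intension_and (μ : Fin (m + 1) → ℝ) (ρ₁ ρ₂ : HypForm m) :
    ∑ h ∈ (ρ₁.and ρ₂).intension, μ h + ∑ h ∈ (ρ₁.and ρ₂.neg).intension, μ h =
      ∑ h ∈ ρ₁.intension, μ h := by
  rw [← Finset.sum_inter_add_sum_sdiff ρ₁.intension ρ₂.intension]
  congr 2
  ext i
  simp [HypForm.intension]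

namespace EvidenceSpace

variable (E : EvidenceSpace m k)

theorem sum_lik_pos (o : Fin (k + 1)) : 0 < ∑ h, E.lik h o := by
  obtain ⟨h, hh⟩ := E.relevant o
  exact Finset.sum_pos' (fun h _ => (E.lik_mem h).1 o) ⟨h, Finset.mem_univ h, hh⟩

theorem weight_nonneg (o : Fin (k + 1)) (h : Fin (m + 1)) : 0 ≤ E.weight o h :=
  div_nonneg ((E.lik_mem h).1 o) (E.sum_lik_pos o).le

theorem sum_weight (o : Fin (k + 1)) : ∑ h, E.weight o h = 1 := by
  simp only [weight]
  rw [← Finset.sum_div, div_self (E.sum_lik_pos o).ne']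

end EvidenceSpace

/-- The content of E3. When the denominator is zero, the nonnegative products `prior h * weight h`
all vanish and `ν` is immaterial. -/
theorem prior_mul_weight_eq {w : World m k} {ν : Fin (m + 1) → ℝ} (hν : w.IsPosterior ν)
    (h : Fin (m + 1)) : w.prior h * w.ev.weight w.obs h =
      ∑ i, ν h * (w.prior i * w.ev.weight w.obs i) := by
  rw [← Finset.mul_sum]
  by_cases h0 : ∑ h, w.prior h * w.ev.weight w.obs h = 0
  · rw [h0, mul_zero]
    exact (Finset.sum_eq_zero_iff_of_nonneg fun h _ => mul_nonneg (w.prior_mem.1 h)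
      (w.ev.weight_nonneg _ h)).1 h0 h (Finset.mem_univ h)
  · rw [hν.2 h0, dempster, div_mul_cancel₀ _ h0]

theorem Provable.valid {φ : Form m k} (h : Provable φ) : Valid φ := by
  intro w ν hν v
  induction h with
  | taut φ h => exact h ℝ _ (FOStr.normal_ofField _ _ _) v
  | mp φ ψ _ _ h₁ h₂ => exact (FOStr.sat_imp_iff _ _ _ _).1 h₂ h₁
  | rcf φ h => exact (FOStr.sat_propFree_iff _ _ _ _ h.1 _ _).2 (h.2 ℝ _ v)
  | h1 => exact (FOStr.sat_disj_iff _ _ _ _).2 ⟨w.hyp, rfl⟩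
  | h2 i j hij =>
    exact (FOStr.sat_imp_iff _ _ _ _).2 fun h₁ h₂ => hij ((show w.hyp = i from h₁) ▸ h₂)
  | o1 => exact (FOStr.sat_disj_iff _ _ _ _).2 ⟨w.obs, rfl⟩
  | o2 i j hij =>
    exact (FOStr.sat_imp_iff _ _ _ _).2 fun h₁ h₂ => hij ((show w.obs = i from h₁) ▸ h₂)
  | pr1 =>
    rw [World.Sat, FOStr.sat_eqInt_iff, pr0, FOStr.val_basic, World.basicVal,
      HypForm.intension_tru, w.prior_mem.2, Int.cast_one]
  | pr2 ρ =>
    rw [World.Sat, FOStr.sat_ge_iff, pr0, FOStr.val_basic, World.basicVal, Int.cast_zero]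
    exact Finset.sum_nonneg fun h _ => w.prior_mem.1 h
  | pr3 ρ₁ ρ₂ =>
    rw [World.Sat, FOStr.sat_eq_iff, FOStr.val_add]
    exact sum_intension_and _ _ _
  | pr4 ρ₁ ρ₂ h =>
    rw [World.Sat, FOStr.sat_eq_iff, pr0, pr0, FOStr.val_basic, FOStr.val_basic, World.basicVal,
      World.basicVal, HypForm.tautEquiv_iff.1 h]
  | po1 =>
    rw [World.Sat, FOStr.sat_eqInt_iff, pr, FOStr.val_basic, World.basicVal,
      HypForm.intension_tru, hν.1.2, Int.cast_one]
  | po2 ρ =>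
    rw [World.Sat, FOStr.sat_ge_iff, pr, FOStr.val_basic, World.basicVal, Int.cast_zero]
    exact Finset.sum_nonneg fun h _ => hν.1.1 h
  | po3 ρ₁ ρ₂ =>
    rw [World.Sat, FOStr.sat_eq_iff, FOStr.val_add]
    exact sum_intension_and _ _ _
  | po4 ρ₁ ρ₂ h =>
    rw [World.Sat, FOStr.sat_eq_iff, pr, pr, FOStr.val_basic, FOStr.val_basic, World.basicVal,
      World.basicVal, HypForm.tautEquiv_iff.1 h]
  | e1 o h =>
    rw [World.Sat, FOStr.sat_ge_iff, wt, FOStr.val_basic, World.basicVal, Int.cast_zero]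
    exact w.ev.weight_nonneg o h
  | e2 o =>
    rw [World.Sat, FOStr.sat_eqInt_iff, FOStr.val_sum, Int.cast_one]
    exact w.ev.sum_weight o
  | e3 o h =>
    rw [World.Sat, axiomE3, FOStr.sat_imp_iff]
    rintro (rfl : w.obs = o)
    rw [FOStr.sat_eq_iff, FOStr.val_sum]
    have := prior_mul_weight_eq hν h
    simpa [FOStr.val, FOStr.valMono, FOStr.ofField, World.basicVal, HypForm.intension] using this
  | e4 =>
    rw [World.Sat, FOStr.sat_axiomE4_iff]
    -- This is the normalizing factor of the weights, so `w(o,h) x_o` is the likelihood of `o` under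
    -- `h`.
    refine ⟨fun o => ∑ h, w.ev.lik h o, w.ev.sum_lik_pos, fun h => ?_⟩
    rw [← (w.ev.lik_mem h).2]
    exact Finset.sum_congr rfl fun o _ => div_mul_cancel₀ _ (w.ev.sum_lik_pos o).ne'

end

/-! ### Derivability from finitely many provable formulas -/

section

variable {m k : ℕ}

/-- `φ` follows from the formulas in a list. -/
def Form.imps : List (Form m k) → Form m k → Form m k
  | [], φ => φ
  | δ :: Δ, φ => Form.imp δ (Form.imps Δ φ)

theorem FOStr.sat_imps_iff {D : Type} (M : FOStr m k D) (v : ℕ → D) (Δ : List (Form m k))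
    (φ : Form m k) : M.Sat v (Form.imps Δ φ) ↔ ((∀ δ ∈ Δ, M.Sat v δ) → M.Sat v φ) := by
  induction Δ with
  | nil => simp [Form.imps]
  | cons δ Δ ih =>
    rw [Form.imps, sat_imp_iff, ih]
    simp only [List.forall_mem_cons, and_imp]

theorem Form.propFree_imps {Δ : List (Form m k)} {φ : Form m k} (hΔ : ∀ δ ∈ Δ, δ.PropFree)
    (hφ : φ.PropFree) : (Form.imps Δ φ).PropFree := by
  induction Δ with
  | nil => exact hφ
  | cons δ Δ ih =>
    rw [List.forall_mem_cons] at hΔ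
    exact ⟨hΔ.1, ih hΔ.2⟩

theorem Provable.of_imps {Δ : List (Form m k)} {φ : Form m k} (hΔ : ∀ δ ∈ Δ, Provable δ)
    (h : Provable (Form.imps Δ φ)) : Provable φ := by
  induction Δ with
  | nil => exact h
  | cons δ Δ ih =>
    rw [List.forall_mem_cons] at hΔ
    exact ih hΔ.2 (Provable.mp _ _ hΔ.1 h)

theorem Provable.of_forall_sat {Δ : Set (Form m k)} (hfin : Δ.Finite) {φ : Form m k}
    (hΔ : ∀ δ ∈ Δ, Provable δ)
    (h : ∀ (D : Type) (M : FOStr m k D) (v : ℕ → D), (∀ δ ∈ Δ, M.Sat v δ) → M.Sat v φ) :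
    Provable φ := by
  have hmem : ∀ δ, δ ∈ hfin.toFinset.toList ↔ δ ∈ Δ := fun δ => by simp
  refine Provable.of_imps (Δ := hfin.toFinset.toList) (fun δ hδ => hΔ δ ((hmem δ).1 hδ))
    (Provable.taut _ fun D _ M _ v => ?_)
  rw [FOStr.sat_imps_iff]
  exact fun h' => h D M v fun δ hδ => h' δ ((hmem δ).2 hδ)

/-- Keeping the premises inside one implication makes it a statement about arbitrary reals in place
of the basic terms, to which transfer and the schema RCF apply. -/
theorem Provable.of_forall_real {Δ : List (Form m k)} {φ : Form m k} (hΔ : ∀ δ ∈ Δ, δ.PropFree)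
    (hφ : φ.PropFree)
    (h : ∀ (b : Basic m k → ℝ) (v : ℕ → ℝ),
      (∀ δ ∈ Δ, (FOStr.ofField b (fun _ => False) (fun _ => False)).Sat v δ) →
      (FOStr.ofField b (fun _ => False) (fun _ => False)).Sat v φ) :
    Provable (Form.imps Δ φ) :=
  Provable.rcf _ (isRCF_of_forall_real (Form.propFree_imps hΔ hφ) fun b v =>
    (FOStr.sat_imps_iff _ _ _ _).2 (h b v))

theorem Provable.of_forall_real_of_three {α β γ φ : Form m k} (hα : Provable α) (hβ : Provable β)
    (hγ : Provable γ) (hα' : α.PropFree) (hβ' : β.PropFree) (hγ' : γ.PropFree) (hφ : φ.PropFree)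
    (h : ∀ (b : Basic m k → ℝ) (v : ℕ → ℝ),
      (FOStr.ofField b (fun _ => False) (fun _ => False)).Sat v α →
      (FOStr.ofField b (fun _ => False) (fun _ => False)).Sat v β →
      (FOStr.ofField b (fun _ => False) (fun _ => False)).Sat v γ →
      (FOStr.ofField b (fun _ => False) (fun _ => False)).Sat v φ) : Provable φ :=
  Provable.of_imps (Δ := [α, β, γ]) (by simp [hα, hβ, hγ])
    (Provable.of_forall_real (by simp [hα', hβ', hγ']) hφ fun b v hb =>
      h b v (hb _ (by simp)) (hb _ (by simp)) (hb _ (by simp)))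

/-! ### Probabilities of hypothesis formulas as sums of probabilities of hypotheses -/

theorem HypForm.intension_and_of_intension_insert {ρ : HypForm m} {h : Fin (m + 1)}
    {s : Finset (Fin (m + 1))} (hs : h ∉ s) (hρ : ρ.intension = insert h s) :
    (ρ.and (prim h)).intension = {h} ∧ (ρ.and (prim h).neg).intension = s := by
  constructor
  · simp [intension, hρ]
  · ext i
    simp only [intension, hρ, Finset.mem_inter, Finset.mem_insert, Finset.mem_sdiff,
      Finset.mem_univ, Finset.mem_singleton, true_and]
    constructor
    · rintro ⟨h1 | h1, h2⟩
      · exact absurd h1 h2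
      · exact h1
    · exact fun h1 => ⟨Or.inr h1, fun h2 => hs (h2 ▸ h1)⟩

/-- The equation `c(ρ) = ∑_{h ∈ s} c(h)`, where `c` is one of `Pr⁰` and `Pr`. -/
def sumEq (c : HypForm m → Basic m k) (ρ : HypForm m) (s : Finset (Fin (m + 1))) : Form m k :=
  Form.eq (Poly.basic (c ρ)) (Poly.sum m fun h =>
    if h ∈ s then Poly.basic (c (HypForm.prim h)) else Poly.mono (Mono.int 0))

theorem sat_sumEq_iff {c : HypForm m → Basic m k} {ρ : HypForm m} {s : Finset (Fin (m + 1))}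
    {b : Basic m k → ℝ} {v : ℕ → ℝ} {hy : Fin (m + 1) → Prop} {ob : Fin (k + 1) → Prop} :
    (FOStr.ofField b hy ob).Sat v (sumEq c ρ s) ↔
      b (c ρ) = ∑ h ∈ s, b (c (HypForm.prim h)) := by
  rw [sumEq, FOStr.sat_eq_iff, FOStr.val_basic, FOStr.val_sum]
  have h : ∀ h, (FOStr.ofField b hy ob).val v
      (if h ∈ s then Poly.basic (c (HypForm.prim h)) else Poly.mono (Mono.int 0)) =
      if h ∈ s then b (c (HypForm.prim h)) else 0 := by
    intro h
    split_ifs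
    · rfl
    · exact Int.cast_zero
  simp only [h, Finset.sum_ite_mem, Finset.univ_inter]

theorem Form.propFree_eq (p q : Poly m k) : (Form.eq p q).PropFree := ⟨trivial, trivial⟩

/-- Additivity splits `ρ` into `ρ ∧ h`, equivalent to `h`, and `ρ ∧ ¬h`, which denotes a smaller
set. For the empty set, `ρ ∧ ρ` and `ρ ∧ ¬ρ` are both equivalent to `ρ`, so `c(ρ) + c(ρ) = c(ρ)`. -/
theorem provable_sumEq (c : HypForm m → Basic m k)
    (hadd : ∀ ρ₁ ρ₂ : HypForm m, Provable (Form.eq (Poly.add (Poly.basic (c (ρ₁.and ρ₂)))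
      (Poly.basic (c (ρ₁.and ρ₂.neg)))) (Poly.basic (c ρ₁))))
    (hcongr : ∀ ρ₁ ρ₂ : HypForm m, ρ₁.TautEquiv ρ₂ →
      Provable (Form.eq (Poly.basic (c ρ₁)) (Poly.basic (c ρ₂))))
    (s : Finset (Fin (m + 1))) (ρ : HypForm m) (hρ : ρ.intension = s) :
    Provable (sumEq c ρ s) := by
  induction s using Finset.induction_on generalizing ρ with
  | empty =>
    refine Provable.of_forall_real_of_three (hadd ρ ρ)
      (hcongr (ρ.and ρ) ρ (HypForm.tautEquiv_iff.2 (by simp [HypForm.intension])))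
      (hcongr (ρ.and ρ.neg) ρ (HypForm.tautEquiv_iff.2 (by simp [HypForm.intension, hρ])))
      (Form.propFree_eq _ _) (Form.propFree_eq _ _) (Form.propFree_eq _ _) (Form.propFree_eq _ _)
      fun b v h1 h2 h3 => ?_
    simp only [FOStr.sat_eq_iff, FOStr.val_add, FOStr.val_basic] at h1 h2 h3
    rw [sat_sumEq_iff, Finset.sum_empty]
    linarith
  | insert h s hs ih =>
    obtain ⟨h1, h2⟩ := HypForm.intension_and_of_intension_insert hs hρ
    refine Provable.of_forall_real_of_three (hadd ρ (HypForm.prim h))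
      (hcongr (ρ.and (HypForm.prim h)) (HypForm.prim h) (HypForm.tautEquiv_iff.2 h1)) (ih _ h2)
      (Form.propFree_eq _ _) (Form.propFree_eq _ _) (Form.propFree_eq _ _) (Form.propFree_eq _ _)
      fun b v h1 h2 h3 => ?_
    simp only [FOStr.sat_eq_iff, FOStr.val_add, FOStr.val_basic, sat_sumEq_iff] at h1 h2 h3
    rw [sat_sumEq_iff, Finset.sum_insert hs]
    linarith

/-! ### Eliminating the primitive propositions -/

/-- The formula with the primitive propositions replaced by their truth values, when `i` is the true
hypothesis and `j` the true observation. -/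
def Form.resolve (i : Fin (m + 1)) (j : Fin (k + 1)) : Form m k → Form m k
  | hyp h => if h = i then or (ge (Poly.mono (Mono.int 0)) 0) (neg (ge (Poly.mono (Mono.int 0)) 0))
      else and (ge (Poly.mono (Mono.int 0)) 0) (neg (ge (Poly.mono (Mono.int 0)) 0))
  | obs o => if o = j then or (ge (Poly.mono (Mono.int 0)) 0) (neg (ge (Poly.mono (Mono.int 0)) 0))
      else and (ge (Poly.mono (Mono.int 0)) 0) (neg (ge (Poly.mono (Mono.int 0)) 0))
  | ge p c => ge p c
  | neg φ => neg (φ.resolve i j)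
  | and φ ψ => and (φ.resolve i j) (ψ.resolve i j)
  | all x φ => all x (φ.resolve i j)

theorem Form.propFree_resolve (i : Fin (m + 1)) (j : Fin (k + 1)) (φ : Form m k) :
    (φ.resolve i j).PropFree := by
  induction φ with
  | hyp h => rw [resolve]; split_ifs <;> exact ⟨trivial, trivial⟩
  | obs o => rw [resolve]; split_ifs <;> exact ⟨trivial, trivial⟩
  | ge p c => trivial
  | neg φ ih => exact ih
  | and φ ψ h₁ h₂ => exact ⟨h₁, h₂⟩
  | all x φ ih => exact ih

theorem FOStr.sat_resolve_iff {D : Type} (M : FOStr m k D) {i : Fin (m + 1)} {j : Fin (k + 1)}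
    (hi : ∀ h, M.hyp h ↔ h = i) (hj : ∀ o, M.obs o ↔ o = j) (v : ℕ → D) (φ : Form m k) :
    M.Sat v (φ.resolve i j) ↔ M.Sat v φ := by
  induction φ generalizing v with
  | hyp h =>
    rw [Sat, hi, Form.resolve]
    split_ifs with hh
    · rw [sat_or_iff, sat_neg_iff]; tauto
    · rw [sat_and_iff, sat_neg_iff]; tauto
  | obs o =>
    rw [Sat, hj, Form.resolve]
    split_ifs with hh
    · rw [sat_or_iff, sat_neg_iff]; tauto
    · rw [sat_and_iff, sat_neg_iff]; tauto
  | ge p c => exact Iff.rfl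
  | neg φ ih => exact not_congr (ih v)
  | and φ ψ h₁ h₂ => exact and_congr (h₁ v) (h₂ v)
  | all x φ ih => exact forall_congr' fun a => ih _

/-! ### Basic terms in a formula -/

/-- The basic terms in a product. -/
def Mono.basics : Mono m k → Set (Basic m k)
  | int _ => ∅
  | basic b => {b}
  | var _ => ∅
  | mul t₁ t₂ => t₁.basics ∪ t₂.basics

/-- The basic terms in a polynomial term. -/
def Poly.basics : Poly m k → Set (Basic m k)
  | mono t => t.basics
  | add p q => p.basics ∪ q.basics

/-- The basic terms in a formula. -/
def Form.basics : Form m k → Set (Basic m k)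
  | hyp _ => ∅
  | obs _ => ∅
  | ge p _ => p.basics
  | neg φ => φ.basics
  | and φ ψ => φ.basics ∪ ψ.basics
  | all _ φ => φ.basics

theorem Mono.finite_basics (t : Mono m k) : t.basics.Finite := by
  induction t with
  | int a => exact Set.finite_empty
  | basic b => exact Set.finite_singleton b
  | var x => exact Set.finite_empty
  | mul t₁ t₂ h₁ h₂ => exact h₁.union h₂

theorem Poly.finite_basics (p : Poly m k) : p.basics.Finite := by
  induction p with
  | mono t => exact t.finite_basics
  | add p q h₁ h₂ => exact h₁.union h₂

theorem Form.finite_basics (φ : Form m k) : φ.basics.Finite := by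
  induction φ with
  | hyp h => exact Set.finite_empty
  | obs o => exact Set.finite_empty
  | ge p c => exact p.finite_basics
  | neg φ ih => exact ih
  | and φ ψ h₁ h₂ => exact h₁.union h₂
  | all x φ ih => exact ih

namespace FOStr

variable {R : Type} [Field R] [LinearOrder R] {b b' : Basic m k → R} {hy : Fin (m + 1) → Prop}
  {ob : Fin (k + 1) → Prop}

theorem valMono_congr {t : Mono m k} (v : ℕ → R) (h : Set.EqOn b b' t.basics) :
    (ofField b hy ob).valMono v t = (ofField b' hy ob).valMono v t := by
  induction t with
  | int a => rfl
  | basic β => exact h rfl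
  | var x => rfl
  | mul t₁ t₂ h₁ h₂ =>
    rw [valMono, valMono, h₁ (h.mono Set.subset_union_left), h₂ (h.mono Set.subset_union_right)]
    rfl

theorem val_congr {p : Poly m k} (v : ℕ → R) (h : Set.EqOn b b' p.basics) :
    (ofField b hy ob).val v p = (ofField b' hy ob).val v p := by
  induction p with
  | mono t => exact valMono_congr v h
  | add p q h₁ h₂ =>
    rw [val_add, val_add, h₁ (h.mono Set.subset_union_left), h₂ (h.mono Set.subset_union_right)]

theorem sat_congr {φ : Form m k} (v : ℕ → R) (h : Set.EqOn b b' φ.basics) :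
    (ofField b hy ob).Sat v φ ↔ (ofField b' hy ob).Sat v φ := by
  induction φ generalizing v with
  | hyp h => exact Iff.rfl
  | obs o => exact Iff.rfl
  | ge p c => rw [sat_ge_iff, sat_ge_iff, val_congr v h]
  | neg φ ih => exact not_congr (ih v h)
  | and φ ψ h₁ h₂ =>
    exact and_congr (h₁ v (h.mono Set.subset_union_left)) (h₂ v (h.mono Set.subset_union_right))
  | all x φ ih => exact forall_congr' fun a => ih _ h

end FOStr

/-! ### Completeness -/

/-- The formulas without primitive propositions that are used to describe the values of the
hypotheses and of the weights of evidence. -/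
inductive CoreAxiom : Form m k → Prop
  | prior_nonneg (h : Fin (m + 1)) : CoreAxiom (Form.ge (pr0 (HypForm.prim h)) 0)
  | prior_tru : CoreAxiom (Form.eqInt (pr0 (HypForm.tru m)) 1)
  | prior_sum : CoreAxiom (sumEq Basic.prior (HypForm.tru m) (HypForm.tru m).intension)
  | post_nonneg (h : Fin (m + 1)) : CoreAxiom (Form.ge (pr (HypForm.prim h)) 0)
  | post_tru : CoreAxiom (Form.eqInt (pr (HypForm.tru m)) 1)
  | post_sum : CoreAxiom (sumEq Basic.post (HypForm.tru m) (HypForm.tru m).intension)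
  | weight_nonneg (o : Fin (k + 1)) (h : Fin (m + 1)) : CoreAxiom (Form.ge (wt o h) 0)
  | weight_sum (o : Fin (k + 1)) : CoreAxiom (Form.eqInt (Poly.sum m fun h => wt o h) 1)
  | weight_lik : CoreAxiom (axiomE4 m k)

theorem provable_sumEq_prior (ρ : HypForm m) :
    Provable (k := k) (sumEq Basic.prior ρ ρ.intension) :=
  provable_sumEq _ Provable.pr3 Provable.pr4 _ ρ rfl

theorem provable_sumEq_post (ρ : HypForm m) :
    Provable (k := k) (sumEq Basic.post ρ ρ.intension) :=
  provable_sumEq _ Provable.po3 Provable.po4 _ ρ rfl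

theorem CoreAxiom.provable {φ : Form m k} (h : CoreAxiom φ) : Provable φ := by
  cases h with
  | prior_nonneg h => exact Provable.pr2 _
  | prior_tru => exact Provable.pr1
  | prior_sum => exact provable_sumEq_prior _
  | post_nonneg h => exact Provable.po2 _
  | post_tru => exact Provable.po1
  | post_sum => exact provable_sumEq_post _
  | weight_nonneg o h => exact Provable.e1 o h
  | weight_sum o => exact Provable.e2 o
  | weight_lik => exact Provable.e4

theorem Form.propFree_conj {n : ℕ} {f : Fin (n + 1) → Form m k} (h : ∀ i, (f i).PropFree) :
    (Form.conj n f).PropFree := by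
  induction n with
  | zero => exact h 0
  | succ n ih => exact ⟨ih fun i => h _, h _⟩

theorem Form.propFree_exs {n : ℕ} {φ : Form m k} (h : φ.PropFree) : (Form.exs n φ).PropFree := by
  induction n generalizing φ with
  | zero => exact h
  | succ n ih => exact ih h

theorem CoreAxiom.propFree {φ : Form m k} (h : CoreAxiom φ) : φ.PropFree := by
  cases h with
  | weight_lik =>
    exact Form.propFree_exs ⟨Form.propFree_conj fun _ => trivial,
      Form.propFree_conj fun _ => ⟨trivial, trivial⟩⟩
  | _ => trivial

/-- Finiteness allows all these axioms to serve as premises of a single formula. -/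
theorem finite_setOf_coreAxiom : {φ : Form m k | CoreAxiom φ}.Finite := by
  refine (((Set.finite_range fun h : Fin (m + 1) =>
    (Form.ge (pr0 (HypForm.prim h)) 0 : Form m k)).union
    (Set.finite_range fun h : Fin (m + 1) => (Form.ge (pr (HypForm.prim h)) 0 : Form m k))).union
    ((Set.finite_range fun p : Fin (k + 1) × Fin (m + 1) =>
      (Form.ge (wt p.1 p.2) 0 : Form m k)).union
    ((Set.finite_range fun o : Fin (k + 1) =>
      (Form.eqInt (Poly.sum m fun h => wt o h) 1 : Form m k)).union
    (Set.toFinite {Form.eqInt (pr0 (HypForm.tru m)) 1,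
      sumEq Basic.prior (HypForm.tru m) (HypForm.tru m).intension,
      Form.eqInt (pr (HypForm.tru m)) 1,
      sumEq Basic.post (HypForm.tru m) (HypForm.tru m).intension, axiomE4 m k})))).subset ?_
  rintro φ h
  cases h with
  | prior_nonneg h => exact Or.inl (Or.inl ⟨h, rfl⟩)
  | post_nonneg h => exact Or.inl (Or.inr ⟨h, rfl⟩)
  | weight_nonneg o h => exact Or.inr (Or.inl ⟨(o, h), rfl⟩)
  | weight_sum o => exact Or.inr (Or.inr (Or.inl ⟨o, rfl⟩))
  | _ => exact Or.inr (Or.inr (Or.inr (by simp)))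

/-- The conclusion of axiom `E3`. -/
def bayesEq (o : Fin (k + 1)) (h : Fin (m + 1)) : Form m k :=
  Form.eq
    (Poly.mono (Mono.mul (Mono.basic (Basic.prior (HypForm.prim h)))
      (Mono.basic (Basic.weight o h))))
    (Poly.sum m fun i =>
      Poly.mono (Mono.mul (Mono.basic (Basic.post (HypForm.prim h)))
        (Mono.mul (Mono.basic (Basic.prior (HypForm.prim i)))
          (Mono.basic (Basic.weight o i)))))

/-- Weights lose the overall scale of each observation and `x` restores it: as the weights of `o`
sum to one, the likelihoods `W o h * x o` of `o` sum to `x o`, and normalizing gives `W` back. -/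
theorem exists_evidenceSpace {W : Fin (k + 1) → Fin (m + 1) → ℝ} (hW : ∀ o h, 0 ≤ W o h)
    (hsum : ∀ o, ∑ h, W o h = 1) {x : Fin (k + 1) → ℝ} (hx : ∀ o, 0 < x o)
    (hlik : ∀ h, ∑ o, W o h * x o = 1) : ∃ E : EvidenceSpace m k, E.weight = W := by
  refine ⟨⟨fun h o => W o h * x o, fun h => ⟨fun o => mul_nonneg (hW o h) (hx o).le, hlik h⟩,
    fun o => ?_⟩, ?_⟩
  · obtain ⟨h, -, hh⟩ := Finset.exists_lt_of_sum_lt (s := Finset.univ) (f := fun _ => (0 : ℝ))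
      (g := W o) (by simp [hsum])
    exact ⟨h, mul_pos hh (hx o)⟩
  · ext o h
    simp only [EvidenceSpace.weight]
    rw [← Finset.sum_mul, hsum, one_mul, mul_div_cancel_right₀ _ (hx o).ne']

/-- Values of the basic terms that satisfy the axioms are the values at some world. -/
theorem exists_world {b : Basic m k → ℝ} {v : ℕ → ℝ} {hy : Fin (m + 1) → Prop}
    {ob : Fin (k + 1) → Prop} (i : Fin (m + 1)) (j : Fin (k + 1))
    (hcore : ∀ φ, CoreAxiom φ → (FOStr.ofField b hy ob).Sat v φ)
    (hbayes : ∀ h, (FOStr.ofField b hy ob).Sat v (bayesEq j h)) :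
    ∃ (w : World m k) (ν : Fin (m + 1) → ℝ), w.hyp = i ∧ w.obs = j ∧ w.IsPosterior ν ∧
      (∀ h, w.prior h = b (Basic.prior (HypForm.prim h))) ∧
      (∀ h, ν h = b (Basic.post (HypForm.prim h))) ∧
      ∀ o h, w.ev.weight o h = b (Basic.weight o h) := by
  obtain ⟨x, hx, hlik⟩ := (FOStr.sat_axiomE4_iff _ _ _ _).1 (hcore _ CoreAxiom.weight_lik)
  obtain ⟨E, hE⟩ := exists_evidenceSpace (W := fun o h => b (Basic.weight o h))
    (fun o h => by
      have := (FOStr.sat_ge_iff _ _ _ _ _ _).1 (hcore _ (CoreAxiom.weight_nonneg o h))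
      rwa [Int.cast_zero] at this)
    (fun o => by
      have := (FOStr.sat_eqInt_iff _ _ _ _ _ _).1 (hcore _ (CoreAxiom.weight_sum o))
      rwa [FOStr.val_sum, Int.cast_one] at this) hx hlik
  have hprior : (fun h => b (Basic.prior (HypForm.prim h))) ∈ stdSimplex ℝ (Fin (m + 1)) := by
    constructor
    · intro h
      have := (FOStr.sat_ge_iff _ _ _ _ _ _).1 (hcore _ (CoreAxiom.prior_nonneg h))
      rwa [Int.cast_zero] at this
    · have h1 := sat_sumEq_iff.1 (hcore _ CoreAxiom.prior_sum)
      have h2 := (FOStr.sat_eqInt_iff _ _ _ _ _ _).1 (hcore _ CoreAxiom.prior_tru)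
      rw [pr0, FOStr.val_basic, h1, HypForm.intension_tru, Int.cast_one] at h2
      exact h2
  have hpost : (fun h => b (Basic.post (HypForm.prim h))) ∈ stdSimplex ℝ (Fin (m + 1)) := by
    constructor
    · intro h
      have := (FOStr.sat_ge_iff _ _ _ _ _ _).1 (hcore _ (CoreAxiom.post_nonneg h))
      rwa [Int.cast_zero] at this
    · have h1 := sat_sumEq_iff.1 (hcore _ CoreAxiom.post_sum)
      have h2 := (FOStr.sat_eqInt_iff _ _ _ _ _ _).1 (hcore _ CoreAxiom.post_tru)
      rw [pr, FOStr.val_basic, h1, HypForm.intension_tru, Int.cast_one] at h2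
      exact h2
  have hW : ∀ o h, E.weight o h = b (Basic.weight o h) := fun o h => by rw [hE]
  refine ⟨⟨i, j, _, hprior, E⟩, _, rfl, rfl, ⟨hpost, fun h0 => funext fun h => ?_⟩,
    fun _ => rfl, fun _ => rfl, hW⟩
  have := (FOStr.sat_eq_iff _ _ _ _ _ _).1 (hbayes h)
  rw [FOStr.val_sum] at this
  -- E3 is Dempster's rule with the denominator cleared; only a nonzero denominator has to be
  -- considered.
  rw [dempster, eq_div_iff h0, Finset.mul_sum]
  simp only [hW]
  exact this.symm

/-- The provable description of the value of a basic term. -/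
def basicEq : Basic m k → Form m k
  | Basic.prior ρ => sumEq Basic.prior ρ ρ.intension
  | Basic.post ρ => sumEq Basic.post ρ ρ.intension
  -- A weight is already atomic, so a trivial equation fills its place.
  | Basic.weight o h => Form.eq (wt o h) (wt o h)

theorem provable_basicEq (β : Basic m k) : Provable (basicEq β) := by
  cases β with
  | prior ρ => exact provable_sumEq_prior ρ
  | post ρ => exact provable_sumEq_post ρ
  | weight o h =>
    exact Provable.rcf _ ⟨Form.propFree_eq _ _, fun R _ _ _ _ b v =>
      (FOStr.sat_eq_iff _ _ _ _ _ _).2 rfl⟩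

theorem propFree_basicEq (β : Basic m k) : (basicEq β).PropFree := by
  cases β <;> exact Form.propFree_eq _ _

theorem Valid.provable_of_hyp_obs {φ : Form m k} (hφ : Valid φ) (i : Fin (m + 1))
    (j : Fin (k + 1)) :
    Provable (Form.imp (Form.and (Form.hyp i) (Form.obs j)) φ) := by
  let Γ : Set (Form m k) := {ψ | CoreAxiom ψ} ∪ (basicEq '' φ.basics)
  have hΓfin : Γ.Finite := finite_setOf_coreAxiom.union (φ.finite_basics.image _)
  have hΓ : ∀ ψ ∈ Γ, Provable ψ := by
    rintro ψ (h | ⟨β, -, rfl⟩)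
    · exact CoreAxiom.provable h
    · exact provable_basicEq β
  -- Unlike `Γ`, the conclusions of E3 are available only under `ob_j`; they stay as premises of
  -- `hmain` and are discharged through E3 at the end.
  let Γ' : Set (Form m k) := Γ ∪ Set.range (bayesEq j)
  have hΓ'fin : Γ'.Finite := hΓfin.union (Set.finite_range _)
  have hmem : ∀ ψ, ψ ∈ hΓ'fin.toFinset.toList ↔ ψ ∈ Γ' := fun ψ => by simp
  have hmain : Provable (Form.imps hΓ'fin.toFinset.toList (φ.resolve i j)) := by
    refine Provable.of_forall_real ?_ (Form.propFree_resolve i j φ) ?_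
    · intro ψ hψ
      rcases (hmem ψ).1 hψ with (h | ⟨β, -, rfl⟩) | ⟨h, rfl⟩
      · exact CoreAxiom.propFree h
      · exact propFree_basicEq β
      · exact Form.propFree_eq _ _
    · intro b v hb
      replace hb : ∀ ψ ∈ Γ', (FOStr.ofField b (fun _ => False) (fun _ => False)).Sat v ψ :=
        fun ψ hψ => hb ψ ((hmem ψ).2 hψ)
      obtain ⟨w, ν, rfl, rfl, hν, h1, h2, h3⟩ := exists_world i j
        (fun ψ hψ => hb ψ (Or.inl (Or.inl hψ))) (fun h => hb _ (Or.inr ⟨h, rfl⟩))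
      rw [FOStr.sat_propFree_iff _ _ _ _ (Form.propFree_resolve _ _ φ) (fun h => w.hyp = h)
        (fun o => w.obs = o), FOStr.sat_resolve_iff _ (fun h => eq_comm) (fun o => eq_comm)]
      -- The world is built from the values at single hypotheses; the equations `basicEq` make it
      -- agree with `b` on all basic terms of `φ`.
      refine (FOStr.sat_congr v ?_).1 (hφ w ν hν v)
      intro β hβ
      have := hb _ (Or.inl (Or.inr ⟨β, hβ, rfl⟩))
      cases β with
      | prior ρ => simp only [World.basicVal, h1, sat_sumEq_iff.1 this]
      | post ρ => simp only [World.basicVal, h2, sat_sumEq_iff.1 this]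
      | weight o h => exact h3 o h
  let Δ : Set (Form m k) := {Form.imps hΓ'fin.toFinset.toList (φ.resolve i j)} ∪ Γ ∪
    Set.range (axiomE3 j) ∪
    (fun h => Form.imp (Form.hyp i) (Form.neg (Form.hyp h))) '' {h | i ≠ h} ∪
    (fun o => Form.imp (Form.obs j) (Form.neg (Form.obs o))) '' {o | j ≠ o}
  refine Provable.of_forall_sat (Δ := Δ) ?_ ?_ ?_
  · exact ((((Set.finite_singleton _).union hΓfin).union (Set.finite_range _)).union
      ((Set.toFinite _).image _)).union ((Set.toFinite _).image _)
  · rintro ψ ((((rfl | h) | ⟨h, rfl⟩) | ⟨h, hh, rfl⟩) | ⟨o, ho, rfl⟩)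
    · exact hmain
    · exact hΓ ψ h
    · exact Provable.e3 j h
    · exact Provable.h2 i h hh
    · exact Provable.o2 j o ho
  · intro D M v hM
    rw [FOStr.sat_imp_iff]
    rintro ⟨hi, hj⟩
    -- In an arbitrary first-order structure, H2 and O2 make `h_i` and `ob_j` the only true
    -- primitive propositions, so `φ` and its resolved form agree.
    have hi' : ∀ h, M.hyp h ↔ h = i := fun h => by
      refine ⟨fun hh => ?_, fun e => e ▸ hi⟩
      by_contra hne
      exact (FOStr.sat_imp_iff _ _ _ _).1 (hM _ (Or.inl (Or.inr ⟨h, Ne.symm hne, rfl⟩))) hi hh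
    have hj' : ∀ o, M.obs o ↔ o = j := fun o => by
      refine ⟨fun hh => ?_, fun e => e ▸ hj⟩
      by_contra hne
      exact (FOStr.sat_imp_iff _ _ _ _).1 (hM _ (Or.inr ⟨o, Ne.symm hne, rfl⟩)) hj hh
    rw [← FOStr.sat_resolve_iff M hi' hj']
    refine (FOStr.sat_imps_iff _ _ _ _).1
      (hM _ (Or.inl (Or.inl (Or.inl (Or.inl rfl))))) fun ψ hψ => ?_
    rcases (hmem ψ).1 hψ with h | ⟨h, rfl⟩
    · exact hM ψ (Or.inl (Or.inl (Or.inl (Or.inr h))))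
    · exact (FOStr.sat_imp_iff _ _ _ _).1 (hM _ (Or.inl (Or.inl (Or.inr ⟨h, rfl⟩)))) hj

/-- By H1 and O1 some pair `h_i`, `ob_j` holds in every structure considered, and each pair has its
own derivation of `φ`. -/
theorem Valid.provable {φ : Form m k} (hφ : Valid φ) : Provable φ := by
  let Δ : Set (Form m k) := {Form.disj m fun i => Form.hyp i, Form.disj k fun j => Form.obs j} ∪
    Set.range fun p : Fin (m + 1) × Fin (k + 1) =>
      Form.imp (Form.and (Form.hyp p.1) (Form.obs p.2)) φ
  refine Provable.of_forall_sat (Δ := Δ) ((Set.toFinite _).union (Set.finite_range _)) ?_ ?_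
  · rintro ψ ((rfl | rfl) | ⟨p, rfl⟩)
    · exact Provable.h1
    · exact Provable.o1
    · exact hφ.provable_of_hyp_obs p.1 p.2
  · intro D M v hM
    obtain ⟨i, hi⟩ := (FOStr.sat_disj_iff _ _ _ _).1 (hM _ (Or.inl (Or.inl rfl)))
    obtain ⟨j, hj⟩ := (FOStr.sat_disj_iff _ _ _ _).1 (hM _ (Or.inl (Or.inr rfl)))
    exact (FOStr.sat_imp_iff _ _ _ _).1 (hM _ (Or.inr ⟨(i, j), rfl⟩)) ⟨hi, hj⟩

end

end EvidenceLogic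

theorem theoremt (m k : ℕ) (φ : EvidenceLogic.Form m k) :
    EvidenceLogic.Provable φ ↔ EvidenceLogic.Valid φ :=
  ⟨EvidenceLogic.Provable.valid, EvidenceLogic.Valid.provable⟩
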